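/- **Setting.** Let $n\ge 0$. Fix real analytic functions $F^\alpha$ and $F^{\alpha\beta}=F^{\beta\alpha}$ on an open subset of $\mathbb R^n$, and real analytic functions $f,f^\alpha$ ($1\le\alpha,\beta\le n$) of $(\phi^\gamma,v^\gamma_a)$, $1\le\gamma\le n$, $a=1,2,3$, on an open subset of $\mathbb R^n\times(\mathbb R^3)^n$. Assume that $f$, $f^\alpha$ and their domain are invariant under simultaneous rotations $v^\gamma\mapsto Rv^\gamma$, $R\in SO(3)$. Repeated indices are summed. Consider the field equations $$\Delta_h\phi^\alpha=f^\alpha(\phi,D\phi),\qquad R_{ab}[h]=F^\alpha(\phi)D_aD_b\phi^\alpha+F^{\alpha\beta}(\phi)D_a\phi^\alpha D_b\phi^\beta+f(\phi,D\phi)\,h_{ab}$$ for a negative definite metric $h$ and scalar fields $\phi^1,\dots,\phi^n$ on a 3-manifold $N$, where $D$ is the Levi-Civita connection of $h$ and $f,f^\alpha$ are evaluated at $\phi^\gamma$ and at the components of $D\phi^\gamma$ in a normal frame as below. A solution $(N,h,\phi)$ of class $C^r$, $r\in\{\infty,\omega\}$, is always taken on a manifold $N$ that is a normal neighbourhood of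 a point $q$: it carries global $h$-normal coordinates $x^a$ of class $C^r$ centred at $q$, with star-shaped range, and a normal frame $c_a$ centred at $q$. The latter means a $C^r$ frame field with $h(c_a,c_b)=-\delta_{ab}$ that is parallel along the geodesics through $q$ and satisfies $c_a=\partial_{x^a}$ at $q$. The fields take values in the domains of the coefficient functions, and $D_{a_p}\cdots D_{a_1}\phi^\alpha(q)$ denotes the components of the iterated covariant derivative in the frame $c_a$. **Spinors.** Put $\epsilon_{01}=-\epsilon_{10}=1$, $\epsilon_{00}=\epsilon_{11}=0$, and $c_{AB}=\alpha^a{}_{AB}c_a$ with $$\alpha^1=\tfrac1{\sqrt2}\begin{pmatrix}-1&0\\0&1\end{pmatrix},\quad \alpha^2=\tfrac1{\sqrt2}\begin{pmatrix}i&0\\0&i\end{pmatrix},\quad \alpha^3=\tfrac1{\sqrt2}\begin{pmatrix}0&1\\1&0\end{pmatrix},$$ so that $h(c_{AB},c_{CD})=-\epsilon_{A(C}\epsilon_{D)B}$. Let $D_{A_pB_p}\cdots D_{A_1B_1}\phi^\alpha(q)=\alpha^{a_p}{}_{A_pB_p}\cdots\alpha^{a_1}{}_{A_1B_1}D_{a_p}\cdots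 D_{a_1}\phi^\alpha(q)$. The *null data* of the solution are the totally symmetric parts $D_{(A_pB_p}\cdots D_{A_1B_1)}\phi^\alpha(q)$, $p\ge0$, or equivalently the symmetric trace-free parts $\mathcal C(D_{a_p}\cdots D_{a_1}\phi^\alpha)(q)$. The *reality condition* for a spinor is $$T_{A_1B_1\cdots A_pB_p}=(-1)^p\,\tau_{A_1}{}^{A_1'}\cdots\tau_{B_p}{}^{B_p'}\,\overline{T_{A_1'B_1'\cdots A_p'B_p'}},\qquad \tau_0{}^{1}=-1,\ \tau_1{}^{0}=1,\ \tau_0{}^0=\tau_1{}^1=0.$$ **Lemma.** (1) Let $\psi^\alpha_{A_pB_p\cdots A_1B_1}$ ($p\ge 0$, $\alpha=1,\dots,n$) be $n$ sequences of totally symmetric spinors satisfying the reality condition. Suppose that a solution of class $C^r$ exists with $$\psi^\alpha_{A_pB_p\cdots A_1B_1}=D_{(A_pB_p}\cdots D_{A_1B_1)}\phi^\alpha(q)\quad\text{for all }p\ge0\text{ and all }\alpha.$$ Then all coefficients $D_{A_pB_p}\cdots D_{A_1B_1}\phi^\alpha(q)$, $p\ge0$, of the normal expansions of the $\phi^\alpha$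 satisfy the reality condition. They are uniquely determined by the $\psi^\alpha$: any two solutions of class $C^r$ of the same field equations with these null data have the same coefficients. (2) Let $(N,h,\phi)$ and $(N',h',\phi')$ be two analytic solutions of the same field equations, with base points $q$ and $q'$. If there is a rotation $R\in SO(3)$ with $$\mathcal C(D_{a_p}\cdots D_{a_1}\phi'^\alpha)(q')=R_{a_pb_p}\cdots R_{a_1b_1}\,\mathcal C(D_{b_p}\cdots D_{b_1}\phi^\alpha)(q)\quad\text{for all }p\ge0\text{ and all }\alpha,$$ then the solutions are isometric near the base points: there is an analytic diffeomorphism $\Psi$ from a neighbourhood of $q$ to a neighbourhood of $q'$ with $\Psi(q)=q'$, $\Psi^*h'=h$ and $\phi'^\alpha\circ\Psi=\phi^\alpha$ for all $\alpha$. -/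

import Mathlib

open scoped Manifold ContDiff

universe u v

noncomputable section

namespace NullData

/-- The coordinate space `ℝ³`. -/
abbrev E3 := EuclideanSpace ℝ (Fin 3)

/-! ### Tensor calculus in a coordinate system -/

/-- The partial derivative `∂_i f`. -/
def pd (i : Fin 3) (f : E3 → ℝ) (y : E3) : ℝ :=
  fderiv ℝ f y (EuclideanSpace.single i 1)

/-- The Christoffel symbol `Γ^i_{jk}` of the Levi-Civita connection of the metric with
components `g`. -/
def christoffel (g : E3 → Matrix (Fin 3) (Fin 3) ℝ) (i j k : Fin 3) (y : E3) : ℝ :=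
  (1 / 2) * ∑ l, (g y)⁻¹ i l *
    (pd j (fun z => g z l k) y + pd k (fun z => g z l j) y - pd l (fun z => g z j k) y)

/-- The Ricci tensor
`R_ij = ∂_l Γ^l_{ij} - ∂_j Γ^l_{il} + Γ^l_{lm} Γ^m_{ij} - Γ^l_{jm} Γ^m_{il}`. -/
def ricci (g : E3 → Matrix (Fin 3) (Fin 3) ℝ) (i j : Fin 3) (y : E3) : ℝ :=
  ∑ l, (pd l (christoffel g l i j) y - pd j (christoffel g l i l) y
    + ∑ m, (christoffel g l l m y * christoffel g m i j y
      - christoffel g l j m y * christoffel g m i l y))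

/-- The components of a covariant tensor of rank `p`. -/
abbrev Tensor (p : ℕ) := (Fin p → Fin 3) → ℝ

/-- The covariant derivative of a covariant tensor field of rank `p`. The index of the derivative
is the first one: `(D T)_{j i_1 ... i_p} = D_j T_{i_1 ... i_p}`. -/
def covDeriv (g : E3 → Matrix (Fin 3) (Fin 3) ℝ) {p : ℕ} (T : E3 → Tensor p) :
    E3 → Tensor (p + 1) := fun y a =>
  pd (a 0) (fun z => T z (Fin.tail a)) y
    - ∑ i, ∑ l, christoffel g l (a 0) (Fin.tail a i) y
        * T y (Function.update (Fin.tail a) i l)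

/-- The tensor field `D_{i_p} ... D_{i_1} φ`, its indices in this order. -/
def iterCovDeriv (g : E3 → Matrix (Fin 3) (Fin 3) ℝ) (φ : E3 → ℝ) :
    (p : ℕ) → E3 → Tensor p
  | 0 => fun y _ => φ y
  | p + 1 => covDeriv g (iterCovDeriv g φ p)

/-- The Laplacian `h^{ij} D_i D_j φ`. -/
def laplacian (g : E3 → Matrix (Fin 3) (Fin 3) ℝ) (φ : E3 → ℝ) (y : E3) : ℝ :=
  ∑ i, ∑ j, (g y)⁻¹ i j * iterCovDeriv g φ 2 y ![i, j]

/-! ### The field equations -/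

/-- The coefficient functions of the system
`Δ φ^α = f^α(φ, Dφ)`,
`R_ab = F^α(φ) D_a D_b φ^α + F^{αβ}(φ) D_a φ^α D_b φ^β + f(φ, Dφ) h_ab`.
`F1`, `F2`, `f0`, `f1` stand for `F^α`, `F^{αβ}`, `f`, `f^α`. The functions `f` and `f^α` are given
as functions of the values `φ^γ` and of the components `D_a φ^γ` in an orthonormal frame; that they
define scalars means that they do not change under a rotation of the frame. -/
structure FieldSystem (n : ℕ) where
  domF : Set (Fin n → ℝ)
  domf : Set ((Fin n → ℝ) × (Fin n → Fin 3 → ℝ))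
  F1 : Fin n → (Fin n → ℝ) → ℝ
  F2 : Fin n → Fin n → (Fin n → ℝ) → ℝ
  f0 : (Fin n → ℝ) × (Fin n → Fin 3 → ℝ) → ℝ
  f1 : Fin n → (Fin n → ℝ) × (Fin n → Fin 3 → ℝ) → ℝ
  isOpen_domF : IsOpen domF
  isOpen_domf : IsOpen domf
  analytic_F1 : ∀ α, AnalyticOnNhd ℝ (F1 α) domF
  analytic_F2 : ∀ α β, AnalyticOnNhd ℝ (F2 α β) domF
  analytic_f0 : AnalyticOnNhd ℝ f0 domf
  analytic_f1 : ∀ α, AnalyticOnNhd ℝ (f1 α) domf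
  F2_symm : ∀ α β, ∀ w ∈ domF, F2 α β w = F2 β α w
  domf_scalar : ∀ R ∈ Matrix.specialOrthogonalGroup (Fin 3) ℝ, ∀ w ∈ domf,
    (w.1, fun γ => R.mulVec (w.2 γ)) ∈ domf
  f0_scalar : ∀ R ∈ Matrix.specialOrthogonalGroup (Fin 3) ℝ, ∀ w ∈ domf,
    f0 (w.1, fun γ => R.mulVec (w.2 γ)) = f0 w
  f1_scalar : ∀ R ∈ Matrix.specialOrthogonalGroup (Fin 3) ℝ, ∀ w ∈ domf, ∀ α,
    f1 α (w.1, fun γ => R.mulVec (w.2 γ)) = f1 α w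

section Manifold

variable {N : Type u} [TopologicalSpace N] [ChartedSpace E3 N]

/-- The components `h_ij` of a bilinear form field in the coordinates `x`. -/
def metricInChart (x : OpenPartialHomeomorph N E3)
    (h : ∀ p : N, TangentSpace (𝓡 3) p →L[ℝ] TangentSpace (𝓡 3) p →L[ℝ] ℝ) :
    E3 → Matrix (Fin 3) (Fin 3) ℝ := fun y =>
  Matrix.of fun i j =>
    h (x.symm y) (mfderiv (𝓡 3) (𝓡 3) x.symm y (EuclideanSpace.single i (1 : ℝ) : E3))
      (mfderiv (𝓡 3) (𝓡 3) x.symm y (EuclideanSpace.single j (1 : ℝ) : E3))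

/-- The components `c^i_a = ⟨dx^i, c_a⟩` of a frame field in the coordinates `x`. -/
def frameInChart (x : OpenPartialHomeomorph N E3)
    (c : Fin 3 → ∀ p : N, TangentSpace (𝓡 3) p) (i a : Fin 3) (y : E3) : ℝ :=
  WithLp.ofLp (p := 2) (V := Fin 3 → ℝ) (mfderiv (𝓡 3) (𝓡 3) x (x.symm y) (c a (x.symm y))) i

end Manifold

/-- A solution `(h, φ)` of class `C^r` of the field equations on a 3-manifold `N` that is a normal
neighbourhood of the point `q`, together with normal coordinates `x` centred at `q` and a normal
frame `c` centred at `q`. -/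
structure NormalSolution {n : ℕ} (S : FieldSystem n) (r : WithTop ℕ∞)
    (N : Type u) [TopologicalSpace N] [ChartedSpace E3 N] [IsManifold (𝓡 3) r N] where
  /-- the base point -/
  q : N
  /-- the metric -/
  h : ∀ p : N, TangentSpace (𝓡 3) p →L[ℝ] TangentSpace (𝓡 3) p →L[ℝ] ℝ
  /-- the scalar fields -/
  φ : Fin n → N → ℝ
  /-- the normal coordinates -/
  x : OpenPartialHomeomorph N E3
  /-- the normal frame -/
  c : Fin 3 → ∀ p : N, TangentSpace (𝓡 3) p
  h_symm : ∀ p v w, h p v w = h p w v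
  h_neg : ∀ p v, v ≠ 0 → h p v v < 0
  φ_reg : ∀ α, ContMDiff (𝓡 3) 𝓘(ℝ, ℝ) r (φ α)
  x_mem : x ∈ IsManifold.maximalAtlas (𝓡 3) r N
  x_source : x.source = Set.univ
  x_target : StarConvex ℝ 0 x.target
  x_q : x q = 0
  h_reg : ∀ i j, ContDiffOn ℝ r (fun y => metricInChart x h y i j) x.target
  c_reg : ∀ i a, ContDiffOn ℝ r (frameInChart x c i a) x.target
  /-- the rays through the origin of the coordinates are geodesics -/
  x_normal : ∀ y ∈ x.target, ∀ i,
    ∑ j, ∑ k, christoffel (metricInChart x h) i j k y * y j * y k = 0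
  c_orthonormal : ∀ p a b, h p (c a p) (c b p) = if a = b then -1 else 0
  /-- at `q` the frame is the coordinate frame -/
  c_q : ∀ i a, frameInChart x c i a 0 = if i = a then 1 else 0
  /-- the frame is parallel along the geodesics through `q` -/
  c_parallel : ∀ y ∈ x.target, ∀ i a,
    ∑ j, y j * (pd j (frameInChart x c i a) y
      + ∑ k, christoffel (metricInChart x h) i j k y * frameInChart x c k a y) = 0
  /-- the values of the fields lie in the domains of the coefficient functions -/
  mem_domF : ∀ y ∈ x.target, (fun γ => φ γ (x.symm y)) ∈ S.domF
  mem_domf : ∀ y ∈ x.target,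
    ((fun γ => φ γ (x.symm y),
      fun γ a => ∑ i, frameInChart x c i a y * pd i (φ γ ∘ x.symm) y) :
        (Fin n → ℝ) × (Fin n → Fin 3 → ℝ)) ∈ S.domf
  /-- the first field equation -/
  eq_laplacian : ∀ y ∈ x.target, ∀ α,
    laplacian (metricInChart x h) (φ α ∘ x.symm) y
      = S.f1 α (fun γ => φ γ (x.symm y),
          fun γ a => ∑ i, frameInChart x c i a y * pd i (φ γ ∘ x.symm) y)
  /-- the second field equation -/
  eq_ricci : ∀ y ∈ x.target, ∀ i j,
    ricci (metricInChart x h) i j y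
      = ∑ α, S.F1 α (fun γ => φ γ (x.symm y))
            * iterCovDeriv (metricInChart x h) (φ α ∘ x.symm) 2 y ![i, j]
        + ∑ α, ∑ β, S.F2 α β (fun γ => φ γ (x.symm y))
            * pd i (φ α ∘ x.symm) y * pd j (φ β ∘ x.symm) y
        + S.f0 (fun γ => φ γ (x.symm y),
            fun γ a => ∑ i, frameInChart x c i a y * pd i (φ γ ∘ x.symm) y)
          * metricInChart x h y i j

/-! ### Frame components at `q`, symmetric trace-free parts, space spinors -/

/-- The frame components `D_{a_p} ... D_{a_1} φ^α (q)`. -/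
def NormalSolution.coeff {n : ℕ} {S : FieldSystem n} {r : WithTop ℕ∞}
    {N : Type u} [TopologicalSpace N] [ChartedSpace E3 N] [IsManifold (𝓡 3) r N]
    (s : NormalSolution S r N) (α : Fin n) (p : ℕ) : Tensor p := fun a =>
  ∑ b : Fin p → Fin 3, (∏ k, frameInChart s.x s.c (b k) (a k) 0)
    * iterCovDeriv (metricInChart s.x s.h) (s.φ α ∘ s.x.symm) p 0 b

/-- The space of symmetric trace-free tensors of rank `p`. -/
def stf (p : ℕ) : Submodule ℝ (EuclideanSpace ℝ (Fin p → Fin 3)) where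
  carrier := {T | (∀ (σ : Equiv.Perm (Fin p)) (a : Fin p → Fin 3), T (a ∘ σ) = T a) ∧
    ∀ i j : Fin p, i ≠ j → ∀ a : Fin p → Fin 3,
      ∑ k, T (Function.update (Function.update a i k) j k) = 0}
  add_mem' := by
    rintro S T ⟨hS, hS'⟩ ⟨hT, hT'⟩
    refine ⟨fun σ a => ?_, fun i j hij a => ?_⟩
    · simp [hS σ a, hT σ a]
    · simp only [PiLp.add_apply, Finset.sum_add_distrib, hS' i j hij a, hT' i j hij a, add_zero]
  zero_mem' := by
    refine ⟨fun σ a => ?_, fun i j hij a => ?_⟩ <;> simp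
  smul_mem' := by
    rintro t T ⟨hT, hT'⟩
    refine ⟨fun σ a => ?_, fun i j hij a => ?_⟩
    · simp [hT σ a]
    · simp only [PiLp.smul_apply, ← Finset.smul_sum, hT' i j hij a, smul_zero]

/-- The symmetric trace-free part `C(T)` of a tensor: its orthogonal projection to the symmetric
trace-free tensors. -/
def stfPart {p : ℕ} (T : Tensor p) : Tensor p := fun a =>
  (stf p).starProjection (WithLp.toLp 2 T) a

/-- The action of a rotation on a tensor, `(R T)_{a_1 ... a_p} = R_{a_1 b_1} ... T_{b_1 ...}`. -/
def rotate (R : Matrix (Fin 3) (Fin 3) ℝ) {p : ℕ} (T : Tensor p) : Tensor p := fun a =>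
  ∑ b : Fin p → Fin 3, (∏ k, R (a k) (b k)) * T b

/-- The components of a spinor `T_{A_1 B_1 ... A_p B_p}`; the index `A_k` has the label `(k, 0)`
and the index `B_k` has the label `(k, 1)`. -/
abbrev Spinor (p : ℕ) := (Fin p × Fin 2 → Fin 2) → ℂ

/-- The spinor `ε_{AB}`, with `ε_{01} = 1`. -/
def eps : Matrix (Fin 2) (Fin 2) ℂ := !![0, 1; -1, 0]

/-- The coefficients in `c_{AB} = α^a_{AB} c_a`. They are symmetric in `A`, `B` and satisfy
`h(c_{AB}, c_{CD}) = - ε_{A(C} ε_{D)B}`. -/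
def waerden : Fin 3 → Matrix (Fin 2) (Fin 2) ℂ :=
  ![((1 / Real.sqrt 2 : ℝ) : ℂ) • !![-1, 0; 0, 1],
    ((1 / Real.sqrt 2 : ℝ) : ℂ) • !![Complex.I, 0; 0, Complex.I],
    ((1 / Real.sqrt 2 : ℝ) : ℂ) • !![0, 1; 1, 0]]

/-- The spinor that corresponds to a tensor. -/
def toSpinor {p : ℕ} (T : Tensor p) : Spinor p := fun s =>
  ∑ a : Fin p → Fin 3, (∏ k, waerden (a k) (s (k, 0)) (s (k, 1))) * (T a : ℂ)

/-- The totally symmetric part `T_{(A_1 B_1 ... A_p B_p)}` of a spinor. -/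
def symPart {p : ℕ} (T : Spinor p) : Spinor p := fun s =>
  (((2 * p).factorial : ℂ))⁻¹ * ∑ σ : Equiv.Perm (Fin p × Fin 2), T (s ∘ σ)

/-- Total symmetry of a spinor. -/
def TotallySymmetric {p : ℕ} (T : Spinor p) : Prop :=
  ∀ (σ : Equiv.Perm (Fin p × Fin 2)) (s : Fin p × Fin 2 → Fin 2), T (s ∘ σ) = T s

/-- `τ_A^{A'}`, obtained from `τ^{BA'} = ε_0^B ε_0^{A'} + ε_1^B ε_1^{A'}` by lowering the first
index, `τ_A^{A'} = τ^{BA'} ε_{BA}`. -/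
def tau (A A' : Fin 2) : ℂ := ∑ B : Fin 2, (if B = A' then 1 else 0) * eps B A

/-- The reality condition
`T_{A_1 B_1 ... A_p B_p} = (-1)^p τ_{A_1}^{A_1'} ... τ_{B_p}^{B_p'} conj T_{A_1' B_1' ...}`. -/
def RealityCondition {p : ℕ} (T : Spinor p) : Prop :=
  ∀ s : Fin p × Fin 2 → Fin 2, T s = (-1) ^ p *
    ∑ s' : Fin p × Fin 2 → Fin 2, (∏ k, tau (s k) (s' k)) * starRingEnd ℂ (T s')

section Data

variable {n : ℕ} {S : FieldSystem n} {r : WithTop ℕ∞}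
  {N : Type u} [TopologicalSpace N] [ChartedSpace E3 N] [IsManifold (𝓡 3) r N]

/-- The spinors `D_{A_p B_p} ... D_{A_1 B_1} φ^α (q)`. -/
def NormalSolution.coeffSpinor (s : NormalSolution S r N) (α : Fin n) (p : ℕ) : Spinor p :=
  toSpinor (s.coeff α p)

/-- The null data `D_{(A_p B_p} ... D_{A_1 B_1)} φ^α (q)` in spinor form. -/
def NormalSolution.nullSpinor (s : NormalSolution S r N) (α : Fin n) (p : ℕ) : Spinor p :=
  symPart (s.coeffSpinor α p)

/-- The null data `C(D_{a_p} ... D_{a_1} φ^α)(q)` in tensor form. -/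
def NormalSolution.nullTensor (s : NormalSolution S r N) (α : Fin n) (p : ℕ) : Tensor p :=
  stfPart (s.coeff α p)

end Data

/-- Two solutions are isometric near their base points: an analytic diffeomorphism between
neighbourhoods of the base points maps base point, metric and scalar fields of one solution to
those of the other. -/
def LocallyIsometric {n : ℕ} {S : FieldSystem n}
    {N : Type u} [TopologicalSpace N] [ChartedSpace E3 N] [IsManifold (𝓡 3) ω N]
    {N' : Type v} [TopologicalSpace N'] [ChartedSpace E3 N'] [IsManifold (𝓡 3) ω N']
    (s : NormalSolution S ω N) (s' : NormalSolution S ω N') : Prop :=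
  ∃ Ψ : OpenPartialHomeomorph N N',
    s.q ∈ Ψ.source ∧ Ψ s.q = s'.q ∧
    ContMDiffOn (𝓡 3) (𝓡 3) ω Ψ Ψ.source ∧ ContMDiffOn (𝓡 3) (𝓡 3) ω Ψ.symm Ψ.target ∧
    (∀ p ∈ Ψ.source, ∀ v w : TangentSpace (𝓡 3) p,
      s'.h (Ψ p) (mfderiv (𝓡 3) (𝓡 3) Ψ p v) (mfderiv (𝓡 3) (𝓡 3) Ψ p w) = s.h p v w) ∧
    ∀ p ∈ Ψ.source, ∀ α, s'.φ α (Ψ p) = s.φ α p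

end NullData

end

noncomputable section

namespace NullData

open Filter Topology
open scoped Matrix

/-!
Two solutions are compared by the jets of their components in normal coordinates at the origin, by
induction on the order `p`. Commuting covariant derivatives costs only terms of lower order, so the
equation for `Δ_h φ` fixes the traces of the derivatives of `φ` of order `p`, and the null data fix
the symmetric trace-free rest. By the Gauss lemma the difference `k` of the two metrics satisfies
`k_ij y^j = 0` up to higher order. In this radial gauge the Euler operator `y^j ∂_j` recovers `k`
from its linearised Riemann tensor, which in three dimensions is determined by the linearised Ricci
tensor and hence by the second field equation. The frame is recovered by the Euler operator from
parallel transport along the rays.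

For analytic solutions whose null data differ by a rotation `R`, the components of one solution are
first rotated; then all jets agree, hence so do the germs, and `y ↦ R y` in normal coordinates is
the isometry. The reality condition holds for every spinor obtained from a real tensor.
-/

/-! ### Jets at the origin -/

section Jets

variable {E F G : Type*} [NormedAddCommGroup E] [NormedSpace ℝ E] [NormedAddCommGroup F]
  [NormedSpace ℝ F] [NormedAddCommGroup G] [NormedSpace ℝ G]

theorem eventually_contDiffAt {f : E → F} {x : E} (hf : ContDiffAt ℝ ∞ f x) (k : ℕ) :
    ∀ᶠ y in 𝓝 x, ContDiffAt ℝ k f y :=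
  (hf.of_le (mod_cast le_top)).eventually (by simp)

theorem eventually_differentiableAt {f : E → F} {x : E} (hf : ContDiffAt ℝ ∞ f x) :
    ∀ᶠ y in 𝓝 x, DifferentiableAt ℝ f y :=
  (eventually_contDiffAt hf 1).mono fun _ hy => hy.differentiableAt (by simp)

theorem contDiffAt_fderiv {f : E → F} {x : E} (hf : ContDiffAt ℝ ∞ f x) :
    ContDiffAt ℝ ∞ (fderiv ℝ f) x :=
  hf.fderiv_right (by simp)

/-- `f` is smooth at the origin and its derivatives of order less than `m` vanish there. -/
structure VanishesTo (m : ℕ) (f : E → F) : Prop where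
  smooth : ContDiffAt ℝ ∞ f 0
  iteratedFDeriv_eq_zero : ∀ k < m, iteratedFDeriv ℝ k f 0 = 0

namespace VanishesTo

variable {m k : ℕ} {f g : E → F}

theorem of_smooth (hf : ContDiffAt ℝ ∞ f 0) : VanishesTo 0 f := ⟨hf, by simp⟩

theorem zero : VanishesTo m fun _ : E => (0 : F) :=
  ⟨contDiffAt_const, fun _ _ => congrFun iteratedFDeriv_fun_zero 0⟩

theorem mono (hf : VanishesTo m f) (h : k ≤ m) : VanishesTo k f :=
  ⟨hf.smooth, fun i hi => hf.2 i (hi.trans_le h)⟩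

theorem congr (hf : VanishesTo m f) (h : f =ᶠ[𝓝 0] g) : VanishesTo m g :=
  ⟨hf.smooth.congr_of_eventuallyEq h.symm, fun k hk =>
    ((h.iteratedFDeriv (𝕜 := ℝ) k).self_of_nhds).symm.trans (hf.2 k hk)⟩

theorem eq_zero (hf : VanishesTo (m + 1) f) : f 0 = 0 := by
  simpa [hf.2 0 m.succ_pos] using (iteratedFDeriv_zero_apply (𝕜 := ℝ) (f := f) (x := 0) 0).symm

theorem one_iff : VanishesTo 1 f ↔ ContDiffAt ℝ ∞ f 0 ∧ f 0 = 0 := by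
  refine ⟨fun h => ⟨h.smooth, h.eq_zero⟩, fun h => ⟨h.1, fun k hk => ?_⟩⟩
  obtain rfl := Nat.lt_one_iff.1 hk
  ext v
  simpa using h.2

theorem succ_iff_fderiv :
    VanishesTo (m + 1) f ↔ VanishesTo 1 f ∧ VanishesTo m (fderiv ℝ f) := by
  have norm_eq (k : ℕ) : ‖iteratedFDeriv ℝ (k + 1) f 0‖ = ‖iteratedFDeriv ℝ k (fderiv ℝ f) 0‖ :=
    norm_iteratedFDeriv_fderiv.symm
  constructor
  · refine fun h => ⟨h.mono (by omega), contDiffAt_fderiv h.smooth, fun k hk => ?_⟩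
    rw [← norm_eq_zero, ← norm_eq, h.2 (k + 1) (by omega), norm_zero]
  · refine fun h => ⟨h.1.smooth, fun k hk => ?_⟩
    cases k with
    | zero => exact h.1.2 0 zero_lt_one
    | succ k => rw [← norm_eq_zero, norm_eq, h.2.2 k (by omega), norm_zero]

theorem clm_comp (L : F →L[ℝ] G) (hf : VanishesTo m f) : VanishesTo m fun y => L (f y) :=
  ⟨L.contDiff.contDiffAt.comp 0 hf.smooth, fun k hk => by
    change iteratedFDeriv ℝ k (L ∘ f) 0 = 0
    rw [L.iteratedFDeriv_comp_left hf.smooth (mod_cast le_top), hf.2 k hk]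
    ext
    simp⟩

theorem add (hf : VanishesTo m f) (hg : VanishesTo m g) : VanishesTo m fun y => f y + g y :=
  ⟨hf.smooth.add hg.smooth, fun k hk => by
    rw [fun_iteratedFDeriv_add_apply (hf.smooth.of_le (mod_cast le_top))
      (hg.smooth.of_le (mod_cast le_top)), hf.2 k hk, hg.2 k hk, add_zero]⟩

theorem sub (hf : VanishesTo m f) (hg : VanishesTo m g) : VanishesTo m fun y => f y - g y := by
  simpa [sub_eq_add_neg] using hf.add (hg.clm_comp (-ContinuousLinearMap.id ℝ F))

theorem sum {ι : Type*} {s : Finset ι} {f : ι → E → F} (hf : ∀ c ∈ s, VanishesTo m (f c)) :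
    VanishesTo m fun y => ∑ c ∈ s, f c y := by
  classical
  induction s using Finset.induction_on with
  | empty => simpa only [Finset.sum_empty] using zero
  | insert c s hc ih =>
    simp only [Finset.sum_insert hc]
    exact (hf c (by simp)).add (ih fun d hd => hf d (by simp [hd]))

theorem mul {a b : ℕ} {f g : E → ℝ} (hf : VanishesTo a f) (hg : VanishesTo b g)
    (h : m ≤ a + b) : VanishesTo m fun y => f y * g y := by
  refine ⟨hf.smooth.mul hg.smooth, fun k hk => ?_⟩
  obtain ⟨u, hfg, hu, h0u⟩ := mem_nhds_iff.1 <| show {y | ContDiffAt ℝ k f y ∧ ContDiffAt ℝ k g y}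
    ∈ 𝓝 0 from (eventually_contDiffAt hf.smooth k).and (eventually_contDiffAt hg.smooth k)
  have leibniz := norm_iteratedFDerivWithin_mul_le
    (fun y hy => (hfg hy).1.contDiffWithinAt) (fun y hy => (hfg hy).2.contDiffWithinAt)
    hu.uniqueDiffOn h0u le_rfl
  simp only [iteratedFDerivWithin_of_isOpen _ hu h0u] at leibniz
  refine norm_le_zero_iff.1 (leibniz.trans (Finset.sum_eq_zero fun i hi => ?_).le)
  rcases lt_or_ge i a with hia | hia
  · simp [hf.2 i hia]
  · simp [hg.2 (k - i) (by rw [Finset.mem_range] at hi; omega)]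

theorem const_mul (c : ℝ) {f : E → ℝ} (hf : VanishesTo m f) : VanishesTo m fun y => c * f y :=
  (of_smooth contDiffAt_const).mul hf m.zero_add.ge

theorem coord {ι : Type*} [Fintype ι] (j : ι) :
    VanishesTo 1 fun y : EuclideanSpace ℝ ι => y j :=
  one_iff.2 ⟨(EuclideanSpace.proj j : _ →L[ℝ] ℝ).contDiff.contDiffAt, rfl⟩

end VanishesTo

/-- `f` and `g` are smooth at the origin and their derivatives of order less than `m` agree
there. -/
structure JetEq (m : ℕ) (f g : E → F) : Prop where
  left : ContDiffAt ℝ ∞ f 0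
  right : ContDiffAt ℝ ∞ g 0
  iteratedFDeriv_eq : ∀ k < m, iteratedFDeriv ℝ k f 0 = iteratedFDeriv ℝ k g 0

namespace JetEq

variable {m k : ℕ} {f g : E → F}

theorem iff_vanishesTo_sub (hf : ContDiffAt ℝ ∞ f 0) (hg : ContDiffAt ℝ ∞ g 0) :
    JetEq m f g ↔ VanishesTo m fun y => f y - g y := by
  have sub_apply (k : ℕ) : iteratedFDeriv ℝ k (fun y => f y - g y) 0
      = iteratedFDeriv ℝ k f 0 - iteratedFDeriv ℝ k g 0 :=
    fun_iteratedFDeriv_sub_apply (hf.of_le (mod_cast le_top)) (hg.of_le (mod_cast le_top))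
  exact ⟨fun h => ⟨hf.sub hg, fun k hk => by rw [sub_apply, h.3 k hk, sub_self]⟩,
    fun h => ⟨hf, hg, fun k hk => sub_eq_zero.1 <| by rw [← sub_apply, h.2 k hk]⟩⟩

theorem sub_vanishesTo (h : JetEq m f g) : VanishesTo m fun y => f y - g y :=
  (iff_vanishesTo_sub h.left h.right).1 h

theorem of_smooth (hf : ContDiffAt ℝ ∞ f 0) (hg : ContDiffAt ℝ ∞ g 0) : JetEq 0 f g :=
  ⟨hf, hg, by simp⟩

theorem mono (h : JetEq m f g) (hk : k ≤ m) : JetEq k f g :=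
  ⟨h.left, h.right, fun i hi => h.3 i (hi.trans_le hk)⟩

theorem congr {f' g' : E → F} (h : JetEq m f g) (hf : f =ᶠ[𝓝 0] f') (hg : g =ᶠ[𝓝 0] g') :
    JetEq m f' g' :=
  (iff_vanishesTo_sub (h.left.congr_of_eventuallyEq hf.symm)
    (h.right.congr_of_eventuallyEq hg.symm)).2 (h.sub_vanishesTo.congr (hf.sub hg))

theorem eq (h : JetEq (m + 1) f g) : f 0 = g 0 := sub_eq_zero.1 h.sub_vanishesTo.eq_zero

theorem add {f' g' : E → F} (h : JetEq m f g) (h' : JetEq m f' g') :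
    JetEq m (fun y => f y + f' y) fun y => g y + g' y :=
  (iff_vanishesTo_sub (h.left.add h'.left) (h.right.add h'.right)).2 <| by
    simpa only [add_sub_add_comm] using h.sub_vanishesTo.add h'.sub_vanishesTo

theorem sub {f' g' : E → F} (h : JetEq m f g) (h' : JetEq m f' g') :
    JetEq m (fun y => f y - f' y) fun y => g y - g' y :=
  (iff_vanishesTo_sub (h.left.sub h'.left) (h.right.sub h'.right)).2 <| by
    simpa only [sub_sub_sub_comm] using h.sub_vanishesTo.sub h'.sub_vanishesTo

theorem sum {ι : Type*} {s : Finset ι} {f g : ι → E → F} (h : ∀ c ∈ s, JetEq m (f c) (g c)) :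
    JetEq m (fun y => ∑ c ∈ s, f c y) fun y => ∑ c ∈ s, g c y :=
  (iff_vanishesTo_sub (ContDiffAt.sum fun c hc => (h c hc).left)
    (ContDiffAt.sum fun c hc => (h c hc).right)).2 <| by
    simpa only [Finset.sum_sub_distrib] using VanishesTo.sum fun c hc => (h c hc).sub_vanishesTo

/-- Faà di Bruno: the `k`-jet of a composition only involves the `k`-jets of its factors. -/
theorem comp {H : F → G} (h : JetEq m f g) (hf : ContDiffAt ℝ ∞ H (f 0))
    (hg : ContDiffAt ℝ ∞ H (g 0)) : JetEq m (fun y => H (f y)) fun y => H (g y) := by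
  refine ⟨hf.comp 0 h.left, hg.comp 0 h.right, fun k hk => ?_⟩
  have h0 : f 0 = g 0 := (h.mono (show 0 + 1 ≤ m by omega)).eq
  change iteratedFDeriv ℝ k (H ∘ f) 0 = iteratedFDeriv ℝ k (H ∘ g) 0
  rw [iteratedFDeriv_comp hf h.left (mod_cast le_top), iteratedFDeriv_comp hg h.right
    (mod_cast le_top), h0]
  refine Finset.sum_congr rfl fun c _ => ?_
  have hp : (fun i => ftaylorSeries ℝ f 0 (c.partSize i))
      = fun i => ftaylorSeries ℝ g 0 (c.partSize i) :=
    funext fun i => h.3 _ ((c.partSize_le i).trans_lt hk)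
  simp only [FormalMultilinearSeries.compAlongOrderedFinpartition, hp]

theorem mul {f g f' g' : E → ℝ} (h : JetEq m f g) (h' : JetEq m f' g') :
    JetEq m (fun y => f y * f' y) fun y => g y * g' y := by
  refine (iff_vanishesTo_sub (h.left.mul h'.left) (h.right.mul h'.right)).2 ?_
  have key := (h.sub_vanishesTo.mul (VanishesTo.of_smooth h'.left) m.add_zero.ge).add
    ((VanishesTo.of_smooth h.right).mul h'.sub_vanishesTo m.zero_add.ge)
  refine key.congr (.of_forall fun y => ?_)
  ring

theorem const_mul (c : ℝ) {f g : E → ℝ} (h : JetEq m f g) :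
    JetEq m (fun y => c * f y) fun y => c * g y :=
  (iff_vanishesTo_sub (contDiffAt_const.mul h.left) (contDiffAt_const.mul h.right)).2 <| by
    simpa only [mul_sub] using h.sub_vanishesTo.const_mul c

theorem coord_mul {ι : Type*} [Fintype ι] {f g : EuclideanSpace ℝ ι → ℝ} (h : JetEq m f g)
    (j : ι) : JetEq (m + 1) (fun y => y j * f y) fun y => y j * g y := by
  have hj := VanishesTo.coord (ι := ι) j
  refine (iff_vanishesTo_sub (hj.smooth.mul h.left) (hj.smooth.mul h.right)).2 ?_
  simpa only [mul_sub] using hj.mul h.sub_vanishesTo (m.add_comm 1).le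

theorem pi {ι : Type*} [Fintype ι] {F : ι → Type*} [∀ i, NormedAddCommGroup (F i)]
    [∀ i, NormedSpace ℝ (F i)] {f g : E → ∀ i, F i}
    (h : ∀ i, JetEq m (fun y => f y i) fun y => g y i) : JetEq m f g := by
  classical
  have hf := contDiffAt_pi.2 fun i => (h i).left
  have hg := contDiffAt_pi.2 fun i => (h i).right
  refine (iff_vanishesTo_sub hf hg).2 ?_
  have key := VanishesTo.sum (s := Finset.univ) fun i _ =>
    (h i).sub_vanishesTo.clm_comp (ContinuousLinearMap.single ℝ F i)
  refine key.congr (.of_forall fun y => funext fun i => ?_)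
  simp [Finset.sum_apply, Finset.sum_pi_single]

theorem prodMk {f' g' : E → G} (h : JetEq m f g) (h' : JetEq m f' g') :
    JetEq m (fun y => (f y, f' y)) fun y => (g y, g' y) := by
  refine (iff_vanishesTo_sub (h.left.prodMk h'.left) (h.right.prodMk h'.right)).2 ?_
  simpa using (h.sub_vanishesTo.clm_comp (.inl ℝ F G)).add
    (h'.sub_vanishesTo.clm_comp (.inr ℝ F G))

end JetEq

theorem eventuallyEq_of_jetEq [CompleteSpace F] {f g : E → F}
    (hf : AnalyticAt ℝ f 0) (hg : AnalyticAt ℝ g 0) (h : ∀ m, JetEq m f g) : f =ᶠ[𝓝 0] g := by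
  obtain ⟨_, r, hf⟩ := hf
  obtain ⟨_, r', hg⟩ := hg
  filter_upwards [Metric.eball_mem_nhds (0 : E) hf.r_pos,
    Metric.eball_mem_nhds (0 : E) hg.r_pos] with y hy hy'
  have hsum := hf.hasSum_iteratedFDeriv hy
  simp only [fun k => (h (k + 1)).iteratedFDeriv_eq k k.lt_succ_self] at hsum
  simpa only [zero_add] using hsum.unique (hg.hasSum_iteratedFDeriv hy')

end Jets

section Euler

variable {E F : Type u} [NormedAddCommGroup E] [NormedSpace ℝ E] [NormedAddCommGroup F]
  [NormedSpace ℝ F]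

/-- The Euler operator `y^j ∂_j`. -/
def euler (f : E → F) (y : E) : F := fderiv ℝ f y y

theorem contDiffAt_euler {f : E → F} (hf : ContDiffAt ℝ ∞ f 0) : ContDiffAt ℝ ∞ (euler f) 0 :=
  (contDiffAt_fderiv hf).clm_apply contDiffAt_id

theorem fderiv_euler {f : E → F} (hf : ContDiffAt ℝ ∞ f 0) :
    fderiv ℝ (euler f) =ᶠ[𝓝 0] fun y => fderiv ℝ f y + euler (fderiv ℝ f) y := by
  filter_upwards [eventually_contDiffAt hf 2,
    eventually_differentiableAt (contDiffAt_fderiv hf)] with y hy hd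
  ext v
  change fderiv ℝ (fun y => fderiv ℝ f y y) y v = _
  rw [fderiv_clm_apply hd differentiableAt_fun_id]
  simp [euler, hy.isSymmSndFDerivAt (by simp) v y]

theorem iteratedFDeriv_euler (k : ℕ) {f : E → F} (hf : ContDiffAt ℝ ∞ f 0) :
    iteratedFDeriv ℝ k (euler f) 0 = (k : ℝ) • iteratedFDeriv ℝ k f 0 := by
  induction k generalizing F with
  | zero => ext; simp [euler]
  | succ k ih =>
    have hf' := contDiffAt_fderiv hf
    have key : iteratedFDeriv ℝ k (fderiv ℝ (euler f)) 0
        = ((k + 1 : ℕ) : ℝ) • iteratedFDeriv ℝ k (fderiv ℝ f) 0 := by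
      rw [((fderiv_euler hf).iteratedFDeriv ℝ k).self_of_nhds,
        fun_iteratedFDeriv_add_apply (hf'.of_le (mod_cast le_top))
          ((contDiffAt_euler hf').of_le (mod_cast le_top)), ih hf', Nat.cast_succ, add_smul,
        one_smul, add_comm]
    ext v
    simp [iteratedFDeriv_succ_apply_right, key]

/-- `y^j ∂_j + c` acts on derivatives of order `k` at the origin as `k + c`, so it is injective
on germs of order `m` if `0 < c + m`. -/
theorem VanishesTo.of_euler {m q : ℕ} {c : ℝ} {f : E → F} (hc : 0 < c + m) (hf : VanishesTo m f)
    (h : VanishesTo q fun y => euler f y + c • f y) : VanishesTo q f := by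
  refine ⟨hf.smooth, fun k hk => ?_⟩
  rcases lt_or_ge k m with hkm | hkm
  · exact hf.2 k hkm
  have hkc : (k : ℝ) + c ≠ 0 := by
    have : (m : ℝ) ≤ k := mod_cast hkm
    linarith
  have hcf : ContDiffAt ℝ ∞ (fun y => c • f y) 0 := contDiffAt_const.smul hf.smooth
  have hd := h.2 k hk
  rw [fun_iteratedFDeriv_add_apply ((contDiffAt_euler hf.smooth).of_le (mod_cast le_top))
    (hcf.of_le (mod_cast le_top)), iteratedFDeriv_euler k hf.smooth,
    iteratedFDeriv_const_smul_apply' (hf.smooth.of_le (mod_cast le_top)), ← add_smul] at hd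
  exact (smul_eq_zero.1 hd).resolve_left hkc

end Euler

/-! ### Partial derivatives -/

section PartialDerivatives

variable {f g : E3 → ℝ}

theorem pd_congr (h : f =ᶠ[𝓝 0] g) (i : Fin 3) : pd i f =ᶠ[𝓝 0] pd i g := by
  filter_upwards [h.fderiv (𝕜 := ℝ)] with y hy
  rw [pd, pd, hy]

theorem contDiffAt_pd {x : E3} (hf : ContDiffAt ℝ ∞ f x) (i : Fin 3) :
    ContDiffAt ℝ ∞ (pd i f) x :=
  (contDiffAt_fderiv hf).clm_apply contDiffAt_const

theorem contDiffAt_coord (j : Fin 3) (y : E3) : ContDiffAt ℝ ∞ (fun z : E3 => z j) y :=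
  (EuclideanSpace.proj j : E3 →L[ℝ] ℝ).contDiff.contDiffAt

theorem pd_add (hf : ContDiffAt ℝ ∞ f 0) (hg : ContDiffAt ℝ ∞ g 0) (i : Fin 3) :
    pd i (fun y => f y + g y) =ᶠ[𝓝 0] fun y => pd i f y + pd i g y := by
  filter_upwards [eventually_differentiableAt hf, eventually_differentiableAt hg] with y h1 h2
  simp [pd, fderiv_fun_add h1 h2]

theorem pd_sub (hf : ContDiffAt ℝ ∞ f 0) (hg : ContDiffAt ℝ ∞ g 0) (i : Fin 3) :
    pd i (fun y => f y - g y) =ᶠ[𝓝 0] fun y => pd i f y - pd i g y := by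
  filter_upwards [eventually_differentiableAt hf, eventually_differentiableAt hg] with y h1 h2
  simp [pd, fderiv_fun_sub h1 h2]

theorem pd_mul (hf : ContDiffAt ℝ ∞ f 0) (hg : ContDiffAt ℝ ∞ g 0) (i : Fin 3) :
    pd i (fun y => f y * g y) =ᶠ[𝓝 0] fun y => f y * pd i g y + g y * pd i f y := by
  filter_upwards [eventually_differentiableAt hf, eventually_differentiableAt hg] with y h1 h2
  simp [pd, fderiv_fun_mul h1 h2]

theorem pd_const_mul (c : ℝ) (hf : ContDiffAt ℝ ∞ f 0) (i : Fin 3) :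
    pd i (fun y => c * f y) =ᶠ[𝓝 0] fun y => c * pd i f y := by
  filter_upwards [eventually_differentiableAt hf] with y hy
  simp [pd, fderiv_const_mul hy]

theorem pd_sum {ι : Type*} {s : Finset ι} {f : ι → E3 → ℝ}
    (hf : ∀ c ∈ s, ContDiffAt ℝ ∞ (f c) 0) (i : Fin 3) :
    pd i (fun y => ∑ c ∈ s, f c y) =ᶠ[𝓝 0] fun y => ∑ c ∈ s, pd i (f c) y := by
  filter_upwards [(Filter.eventually_all_finset s).2 fun c hc =>
    eventually_differentiableAt (hf c hc)] with y hy
  simp [pd, fderiv_fun_sum hy]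

theorem pd_coord (i j : Fin 3) (y : E3) : pd i (fun z => z j) y = if j = i then 1 else 0 := by
  have : fderiv ℝ (fun z : E3 => z j) y = EuclideanSpace.proj j :=
    (EuclideanSpace.proj j : E3 →L[ℝ] ℝ).fderiv
  simp [pd, this]

theorem pd_pd_eq_fderiv_fderiv {y : E3} (hf : DifferentiableAt ℝ (fderiv ℝ f) y) (i j : Fin 3) :
    pd i (pd j f) y
      = fderiv ℝ (fderiv ℝ f) y (EuclideanSpace.single i 1) (EuclideanSpace.single j 1) := by
  change fderiv ℝ (fun z => fderiv ℝ f z (EuclideanSpace.single j 1)) y _ = _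
  rw [fderiv_clm_apply hf (differentiableAt_const _)]
  simp

theorem pd_comm (hf : ContDiffAt ℝ ∞ f 0) (i j : Fin 3) :
    pd i (pd j f) =ᶠ[𝓝 0] pd j (pd i f) := by
  filter_upwards [eventually_contDiffAt hf 2,
    eventually_differentiableAt (contDiffAt_fderiv hf)] with y hy hd
  rw [pd_pd_eq_fderiv_fderiv hd, pd_pd_eq_fderiv_fderiv hd]
  exact hy.isSymmSndFDerivAt (by simp) _ _

theorem fderiv_apply_eq_sum_pd (f : E3 → ℝ) (y v : E3) :
    fderiv ℝ f y v = ∑ j, v j * pd j f y := by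
  conv_lhs => rw [← (EuclideanSpace.basisFun (Fin 3) ℝ).sum_repr v]
  simp [pd]

namespace VanishesTo

variable {m : ℕ}

theorem pd (hf : VanishesTo (m + 1) f) (i : Fin 3) : VanishesTo m (pd i f) :=
  (succ_iff_fderiv.1 hf).2.clm_comp (.apply ℝ ℝ (EuclideanSpace.single i 1))

theorem of_pd (hf : VanishesTo 1 f) (h : ∀ i, VanishesTo m (NullData.pd i f)) :
    VanishesTo (m + 1) f := by
  refine succ_iff_fderiv.2 ⟨hf, ?_⟩
  have key := VanishesTo.sum (s := Finset.univ) fun i _ => (h i).clm_comp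
    (.toSpanSingleton ℝ (EuclideanSpace.proj i : E3 →L[ℝ] ℝ))
  refine key.congr (.of_forall fun y => ContinuousLinearMap.ext fun v => ?_)
  simp [fderiv_apply_eq_sum_pd, mul_comm]

end VanishesTo

theorem JetEq.pd {m : ℕ} (h : JetEq (m + 1) f g) (i : Fin 3) : JetEq m (pd i f) (pd i g) :=
  (iff_vanishesTo_sub (contDiffAt_pd h.left i) (contDiffAt_pd h.right i)).2
    ((h.sub_vanishesTo.pd i).congr (pd_sub h.left h.right i))

/-- Iterated partial derivatives. -/
def pds (l : List (Fin 3)) (f : E3 → ℝ) : E3 → ℝ := l.foldr pd f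

theorem contDiffAt_pds (hf : ContDiffAt ℝ ∞ f 0) :
    ∀ l : List (Fin 3), ContDiffAt ℝ ∞ (pds l f) 0
  | [] => hf
  | i :: l => contDiffAt_pd (contDiffAt_pds hf l) i

theorem pds_append (l l' : List (Fin 3)) (f : E3 → ℝ) : pds (l ++ l') f = pds l (pds l' f) :=
  List.foldr_append

theorem pds_perm (hf : ContDiffAt ℝ ∞ f 0) {l l' : List (Fin 3)} (h : l.Perm l') :
    pds l f =ᶠ[𝓝 0] pds l' f := by
  induction h with
  | nil => rfl
  | cons i _ ih => exact pd_congr ih i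
  | swap i j l => exact pd_comm (contDiffAt_pds hf l) j i
  | trans _ _ h1 h2 => exact h1.trans h2

theorem pds_sum {ι : Type*} {s : Finset ι} {f : ι → E3 → ℝ}
    (hf : ∀ c ∈ s, ContDiffAt ℝ ∞ (f c) 0) : ∀ l : List (Fin 3),
    pds l (fun y => ∑ c ∈ s, f c y) =ᶠ[𝓝 0] fun y => ∑ c ∈ s, pds l (f c) y
  | [] => EventuallyEq.rfl
  | i :: l => (pd_congr (pds_sum hf l) i).trans
      (pd_sum (fun c hc => contDiffAt_pds (hf c hc) l) i)

namespace VanishesTo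

variable {m : ℕ}

theorem pds : ∀ {m : ℕ} {l : List (Fin 3)}, VanishesTo (m + l.length) f → VanishesTo m (pds l f)
  | _, [], h => h
  | m, i :: l, h => (VanishesTo.pds (m := m + 1) (l := l)
      (h.mono (by rw [List.length_cons]; omega))).pd i

theorem succ_of_pds : ∀ {m : ℕ} {f : E3 → ℝ}, VanishesTo m f →
    (∀ l : List (Fin 3), l.length = m → NullData.pds l f 0 = 0) → VanishesTo (m + 1) f
  | 0, _, hf, h => one_iff.2 ⟨hf.smooth, h [] rfl⟩
  | m + 1, f, hf, h => of_pd (hf.mono (by omega)) fun i => succ_of_pds (hf.pd i) fun l hl =>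
      (congrFun (pds_append l [i] f) 0).symm.trans (h (l ++ [i]) (by simp [hl]))

end VanishesTo

end PartialDerivatives

/-! ### The Gauss lemma -/

/-- The contraction `y^l k_l` of a covector field with the position vector. -/
def radial (k : Fin 3 → E3 → ℝ) (y : E3) : ℝ := ∑ l, y l * k l y

theorem euler_eq_radial_pd (f : E3 → ℝ) : euler f = radial fun j => pd j f :=
  funext fun y => fderiv_apply_eq_sum_pd f y y

theorem VanishesTo.radial {m : ℕ} {k : Fin 3 → E3 → ℝ} (hk : ∀ l, VanishesTo m (k l)) :
    VanishesTo (m + 1) (radial k) :=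
  .sum fun l _ => (VanishesTo.coord l).mul (hk l) (by omega)

section Radial

variable {k : Fin 3 → E3 → ℝ}

theorem contDiffAt_radial (hk : ∀ l, ContDiffAt ℝ ∞ (k l) 0) : ContDiffAt ℝ ∞ (radial k) 0 :=
  ContDiffAt.sum fun l _ => (contDiffAt_coord l 0).mul (hk l)

theorem pd_radial (hk : ∀ l, ContDiffAt ℝ ∞ (k l) 0) (i : Fin 3) :
    pd i (radial k) =ᶠ[𝓝 0] fun y => k i y + radial (fun l => pd i (k l)) y := by
  have hsum := pd_sum (s := Finset.univ) (f := fun l y => y l * k l y)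
    (fun l _ => (contDiffAt_coord l 0).mul (hk l)) i
  have hmul := Filter.eventually_all.2 fun l => pd_mul (contDiffAt_coord l 0) (hk l) i
  filter_upwards [hsum, hmul] with y hsum hmul
  change pd i (fun y => ∑ l, y l * k l y) y = _
  simp only [hsum, hmul, pd_coord, radial, Finset.sum_add_distrib, mul_ite, mul_one, mul_zero,
    Finset.sum_ite_eq', Finset.mem_univ, if_true, add_comm]

theorem pd_pd_radial (hk : ∀ l, ContDiffAt ℝ ∞ (k l) 0) (i j : Fin 3) :
    pd i (pd j (radial k)) =ᶠ[𝓝 0]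
      fun y => pd i (k j) y + pd j (k i) y + radial (fun l => pd i (pd j (k l))) y := by
  have hk' := fun l => contDiffAt_pd (hk l) j
  filter_upwards [pd_congr (pd_radial hk j) i, pd_add (hk j) (contDiffAt_radial hk') i,
    pd_radial hk' i] with y h1 h2 h3
  rw [h1, h2, h3, add_assoc]

theorem euler_radial (hk : ∀ l, ContDiffAt ℝ ∞ (k l) 0) :
    euler (radial k) =ᶠ[𝓝 0] fun y => radial k y + radial (fun l => euler (k l)) y := by
  filter_upwards [Filter.eventually_all.2 fun i => pd_radial hk i] with y hy
  simp only [euler_eq_radial_pd, radial, hy, mul_add, Finset.sum_add_distrib, Finset.mul_sum]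
  congr 1
  rw [Finset.sum_comm]
  exact Finset.sum_congr rfl fun l _ => Finset.sum_congr rfl fun j _ => by ring

end Radial

/-- Twice the Christoffel symbols of the first kind of a metric with components `G`. -/
def christoffelFirst (G : Fin 3 → Fin 3 → E3 → ℝ) (l j k : Fin 3) (y : E3) : ℝ :=
  pd j (G l k) y + pd k (G l j) y - pd l (G j k) y

/-- The rays through the origin are geodesics of the metric with components `G`, up to a constant
matrix added to `G`. -/
def HasRadialGeodesics (G : Fin 3 → Fin 3 → E3 → ℝ) : Prop :=
  ∀ᶠ y in 𝓝 (0 : E3), ∀ l, ∑ j, ∑ k, christoffelFirst G l j k y * y j * y k = 0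

namespace HasRadialGeodesics

variable {G : Fin 3 → Fin 3 → E3 → ℝ}

theorem pd_radial_radial (hn : HasRadialGeodesics G) (hG : ∀ i j, ContDiffAt ℝ ∞ (G i j) 0)
    (hs : ∀ i j, G i j = G j i) (l : Fin 3) :
    pd l (radial fun i => radial (G i)) =ᶠ[𝓝 0] fun y => 2 * euler (radial (G l)) y := by
  filter_upwards [hn, pd_radial (fun i => contDiffAt_radial (hG i)) l,
    Filter.eventually_all.2 fun i => pd_radial (hG i) l, euler_radial (hG l)] with y hn h1 h2 h3
  have hnl := hn l
  simp only [h1, h3, euler_eq_radial_pd, radial, h2, christoffelFirst] at hnl ⊢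
  simp only [Fin.sum_univ_three, hs 0 l, hs 1 l, hs 2 l] at hnl ⊢
  linear_combination -hnl

theorem euler_radial_radial (hn : HasRadialGeodesics G) (hG : ∀ i j, ContDiffAt ℝ ∞ (G i j) 0)
    (hs : ∀ i j, G i j = G j i) :
    euler (radial fun i => radial (G i)) =ᶠ[𝓝 0] fun y => 2 * radial (fun i => radial (G i)) y := by
  filter_upwards [Filter.eventually_all.2 fun l => hn.pd_radial_radial hG hs l,
    euler_radial fun i => contDiffAt_radial (hG i)] with y h1 h2
  have h3 : euler (radial fun i => radial (G i)) y
      = 2 * radial (fun l => euler (radial (G l))) y := by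
    rw [euler_eq_radial_pd]
    simp only [radial] at h1 ⊢
    simp only [h1, Finset.mul_sum]
    exact Finset.sum_congr rfl fun l _ => by ring
  linarith

/-- The Gauss lemma for jets. -/
theorem vanishesTo_radial (hn : HasRadialGeodesics G) (hG : ∀ i j, VanishesTo 1 (G i j))
    (hs : ∀ i j, G i j = G j i) (m : ℕ) (l : Fin 3) : VanishesTo m (radial (G l)) := by
  have hsm := fun i j => (hG i j).smooth
  have hQ : VanishesTo (m + 1) (radial fun i => radial (G i)) := by
    refine .of_euler (m := 3) (c := -2) (by norm_num) (.radial fun i => .radial (hG i))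
      (VanishesTo.zero.congr ?_)
    filter_upwards [hn.euler_radial_radial hsm hs] with y hy
    simp [hy]
  refine .of_euler (m := 2) (c := 0) (by norm_num) (.radial (hG l))
    (((hQ.pd l).const_mul (1 / 2)).congr ?_)
  filter_upwards [hn.pd_radial_radial hsm hs l] with y hy
  simp [hy]

end HasRadialGeodesics

/-! ### The linearised Ricci tensor in radial gauge -/

/-- The linearisation at the Euclidean metric of the Ricci tensor, as a function of the second
derivatives `s i j a b = ∂_i ∂_j k_ab`. -/
def linRicci (s : Fin 3 → Fin 3 → Fin 3 → Fin 3 → ℝ) (i j : Fin 3) : ℝ :=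
  (1 / 2) * ∑ l, (s l i l j + s l j l i - s l l i j - s j i l l)

/-- The linearisation of the Schouten tensor `R_ij - (1/4) R δ_ij`. -/
def linSchouten (s : Fin 3 → Fin 3 → Fin 3 → Fin 3 → ℝ) (i j : Fin 3) : ℝ :=
  linRicci s i j - (1 / 4) * (∑ m, linRicci s m m) * if i = j then 1 else 0

/-- Twice the linearised Riemann tensor. -/
def linRiemann (s : Fin 3 → Fin 3 → Fin 3 → Fin 3 → ℝ) (i j k l : Fin 3) : ℝ :=
  s j k i l + s i l j k - s i k j l - s j l i k

/-- The Kulkarni–Nomizu product `δ ∧ t` of the Euclidean metric with a symmetric tensor `t`. -/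
def kulkarniNomizu (t : Fin 3 → Fin 3 → ℝ) (i j k l : Fin 3) : ℝ :=
  (if i = k then 1 else 0) * t j l + (if j = l then 1 else 0) * t i k
    - (if i = l then 1 else 0) * t j k - (if j = k then 1 else 0) * t i l

theorem eq_of_antisymm {u v : Fin 3 → Fin 3 → ℝ} (hu : ∀ i j, u i j = -u j i)
    (hv : ∀ i j, v i j = -v j i) (h : ∀ m, u (m + 1) (m + 2) = v (m + 1) (m + 2)) (i j : Fin 3) :
    u i j = v i j := by
  have h0 : u 1 2 = v 1 2 := h 0
  have h1 : u 2 0 = v 2 0 := h 1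
  have h2 : u 0 1 = v 0 1 := h 2
  have huij := hu i j
  have hvij := hv i j
  fin_cases i <;> fin_cases j <;> simp only [Fin.isValue, Fin.zero_eta, Fin.mk_one,
    Fin.reduceFinMk] at huij hvij ⊢ <;> linarith

/-- The Weyl tensor vanishes in three dimensions. -/
theorem linRiemann_eq_kulkarniNomizu (s : Fin 3 → Fin 3 → Fin 3 → Fin 3 → ℝ)
    (h1 : ∀ i j a b, s i j a b = s j i a b) (h2 : ∀ i j a b, s i j a b = s i j b a)
    (i j k l : Fin 3) :
    linRiemann s i j k l = 2 * kulkarniNomizu (linSchouten s) i j k l := by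
  refine eq_of_antisymm (u := fun i j => linRiemann s i j k l)
    (v := fun i j => 2 * kulkarniNomizu (linSchouten s) i j k l)
    (fun i j => by simp only [linRiemann]; ring) (fun i j => by simp only [kulkarniNomizu]; ring)
    (fun m => ?_) i j
  refine eq_of_antisymm (u := linRiemann s (m + 1) (m + 2))
    (v := fun k l => 2 * kulkarniNomizu (linSchouten s) (m + 1) (m + 2) k l)
    (fun k l => by simp only [linRiemann]; ring) (fun k l => by simp only [kulkarniNomizu]; ring)
    (fun n => ?_) k l
  have e (a b) : s 1 0 a b = s 0 1 a b ∧ s 2 0 a b = s 0 2 a b ∧ s 2 1 a b = s 1 2 a b :=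
    ⟨h1 .., h1 .., h1 ..⟩
  have f (a b) : s a b 1 0 = s a b 0 1 ∧ s a b 2 0 = s a b 0 2 ∧ s a b 2 1 = s a b 1 2 :=
    ⟨h2 .., h2 .., h2 ..⟩
  fin_cases m <;> fin_cases n <;>
    simp [linRiemann, kulkarniNomizu, linSchouten, linRicci, Fin.sum_univ_three, e, f] <;> ring

/-- The second derivatives `∂_i ∂_j k_ab`. -/
def hess (k : Fin 3 → Fin 3 → E3 → ℝ) (y : E3) (i j a b : Fin 3) : ℝ := pd i (pd j (k a b)) y

section RadialGauge

variable {k : Fin 3 → Fin 3 → E3 → ℝ}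

theorem vanishesTo_linRiemann {q : ℕ} (hk : ∀ i j, ContDiffAt ℝ ∞ (k i j) 0)
    (hs : ∀ i j, k i j = k j i) (hR : ∀ i j, VanishesTo q fun y => linRicci (hess k y) i j)
    (i j a b : Fin 3) : VanishesTo q fun y => linRiemann (hess k y) i j a b := by
  have htr : VanishesTo q fun y => (1 / 4) * ∑ m, linRicci (hess k y) m m :=
    (VanishesTo.sum fun m _ => hR m m).const_mul _
  have hS (c d : Fin 3) : VanishesTo q fun y => linSchouten (hess k y) c d := by
    refine ((hR c d).sub (htr.const_mul (if c = d then 1 else 0))).congr (.of_forall fun y => ?_)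
    simp only [linSchouten, mul_comm]
  have key := ((((hS j b).const_mul (if i = a then 1 else 0)).add
    ((hS i a).const_mul (if j = b then 1 else 0))).sub
    ((hS j a).const_mul (if i = b then 1 else 0))).sub
    ((hS i b).const_mul (if j = a then 1 else 0))
  refine (key.const_mul 2).congr ?_
  filter_upwards [Filter.eventually_all.2 fun c => Filter.eventually_all.2 fun d =>
    Filter.eventually_all.2 fun i => Filter.eventually_all.2 fun j => pd_comm (hk i j) c d]
    with y hc
  exact (linRiemann_eq_kulkarniNomizu (hess k y) hc
    (fun c d i j => congrArg (fun f => pd c (pd d f) y) (hs i j)) i j a b).symm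

theorem euler_euler_add_euler (hk : ∀ i j, ContDiffAt ℝ ∞ (k i j) 0) (hs : ∀ i j, k i j = k j i)
    (i j : Fin 3) : ∀ᶠ y in 𝓝 0, euler (euler (k i j)) y + euler (k i j) y
      = euler (pd j (radial (k i))) y + euler (pd i (radial (k j))) y
        - radial (fun c => pd i (pd j (radial (k c)))) y
        - ∑ a, ∑ b, y a * y b * linRiemann (hess k y) i a j b := by
  filter_upwards [Filter.eventually_all.2 fun l => Filter.eventually_all.2 fun a =>
      Filter.eventually_all.2 fun b => pd_pd_radial (hk l) a b,
    euler_radial fun c => contDiffAt_pd (hk i j) c,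
    Filter.eventually_all.2 fun a => Filter.eventually_all.2 fun c => pd_comm (hk i c) a j,
    Filter.eventually_all.2 fun a => Filter.eventually_all.2 fun c => pd_comm (hk j c) a i]
    with y hA hE hcj hci
  simp only [euler_eq_radial_pd] at hE ⊢
  rw [hE]
  simp only [radial, linRiemann, hess] at hA ⊢
  simp only [hA]
  simp only [Fin.sum_univ_three, hs 0 i, hs 1 i, hs 2 i, hs 0 j, hs 1 j, hs 2 j, hcj, hci, hs j i]
  ring

theorem vanishesTo_of_linRicci {q : ℕ} (hk : ∀ i j, VanishesTo 1 (k i j))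
    (hs : ∀ i j, k i j = k j i) (hA : ∀ m l, VanishesTo m (radial (k l)))
    (hR : ∀ i j, VanishesTo q fun y => linRicci (hess k y) i j) (i j : Fin 3) :
    VanishesTo (q + 2) (k i j) := by
  have hsm := fun i j => (hk i j).smooth
  have hRiem : VanishesTo (q + 2) fun y =>
      ∑ a, ∑ b, y a * y b * linRiemann (hess k y) i a j b :=
    .sum fun a _ => .sum fun b _ => ((VanishesTo.coord a).mul (.coord b) le_rfl).mul
      (vanishesTo_linRiemann hsm hs hR i a j b) (by omega)
  have hA1 (l a : Fin 3) : VanishesTo (q + 2) (euler (pd a (radial (k l)))) := by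
    rw [euler_eq_radial_pd]
    exact .radial fun c => ((hA (q + 3) l).pd a).pd c
  have hA2 : VanishesTo (q + 2) (radial fun c => pd i (pd j (radial (k c)))) :=
    .radial fun c => ((hA (q + 3) c).pd j).pd i
  have hEE : VanishesTo (q + 2) fun y => euler (euler (k i j)) y + (1 : ℝ) • euler (k i j) y := by
    refine ((((hA1 i j).add (hA1 j i)).sub hA2).sub hRiem).congr ?_
    filter_upwards [euler_euler_add_euler hsm hs i j] with y hy
    rw [one_smul, hy]
  have hE : VanishesTo (q + 2) (euler (k i j)) :=
    .of_euler (m := 0) (by norm_num) (.of_smooth (contDiffAt_euler (hsm i j))) hEE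
  exact .of_euler (m := 1) (c := 0) (by norm_num) (hk i j) (by simpa using hE)

end RadialGauge

/-! ### Jets of the Levi-Civita connection and of its curvature -/

theorem contDiffAt_inv_apply {M : Fin 3 → Fin 3 → ℝ} (hM : (Matrix.of M).det ≠ 0) (i j : Fin 3) :
    ContDiffAt ℝ ∞ (fun M : Fin 3 → Fin 3 → ℝ => (Matrix.of M)⁻¹ i j) M := by
  have hdet {f : (Fin 3 → Fin 3 → ℝ) → Matrix (Fin 3) (Fin 3) ℝ}
      (hf : ∀ a b, ContDiffAt ℝ ∞ (fun M => f M a b) M) :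
      ContDiffAt ℝ ∞ (fun M => (f M).det) M := by
    simp only [Matrix.det_apply']
    exact ContDiffAt.sum fun σ _ => contDiffAt_const.mul (contDiffAt_prod fun k _ => hf _ _)
  have hentry (a b : Fin 3) : ContDiffAt ℝ ∞ (fun M : Fin 3 → Fin 3 → ℝ => Matrix.of M a b) M :=
    (contDiff_apply_apply ℝ ℝ a b).contDiffAt
  have hadj : ContDiffAt ℝ ∞ (fun M => (Matrix.of M).adjugate i j) M := by
    simp only [Matrix.adjugate_apply]
    refine hdet fun a b => ?_
    simp only [Matrix.updateRow_apply]
    split_ifs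
    exacts [contDiffAt_const, hentry a b]
  simpa [Matrix.inv_def] using ((hdet hentry).inv hM).mul hadj

/-- The components of `g` are smooth at the origin and `g` is invertible there. -/
structure SmoothMetric (g : E3 → Matrix (Fin 3) (Fin 3) ℝ) : Prop where
  smooth : ∀ i j, ContDiffAt ℝ ∞ (fun y => g y i j) 0
  det_ne : (g 0).det ≠ 0

/-- The components of `g - g'`. -/
def metricDiff (g g' : E3 → Matrix (Fin 3) (Fin 3) ℝ) (i j : Fin 3) (y : E3) : ℝ :=
  g y i j - g' y i j

/-- The metrics `g` and `g'` are smooth and agree to order `m` at the origin. -/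
structure MetricJetEq (m : ℕ) (g g' : E3 → Matrix (Fin 3) (Fin 3) ℝ) : Prop where
  left : SmoothMetric g
  right : SmoothMetric g'
  jetEq : ∀ i j, JetEq m (fun y => g y i j) fun y => g' y i j

theorem contDiffAt_christoffelFirst {k : Fin 3 → Fin 3 → E3 → ℝ}
    (hk : ∀ i j, ContDiffAt ℝ ∞ (k i j) 0) (l i j : Fin 3) :
    ContDiffAt ℝ ∞ (christoffelFirst k l i j) 0 :=
  ((contDiffAt_pd (hk l j) i).add (contDiffAt_pd (hk l i) j)).sub (contDiffAt_pd (hk i j) l)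

theorem pd_christoffelFirst {k : Fin 3 → Fin 3 → E3 → ℝ} (hk : ∀ i j, ContDiffAt ℝ ∞ (k i j) 0)
    (d l i j : Fin 3) : pd d (christoffelFirst k l i j) =ᶠ[𝓝 0]
      fun y => hess k y d i l j + hess k y d j l i - hess k y d l i j := by
  have h1 := contDiffAt_pd (hk l j) i
  have h2 := contDiffAt_pd (hk l i) j
  filter_upwards [pd_sub (h1.add h2) (contDiffAt_pd (hk i j) l) d, pd_add h1 h2 d] with y hsub hadd
  exact hsub.trans (congrArg (· - _) hadd)

theorem christoffelFirst_metricDiff {g g' : E3 → Matrix (Fin 3) (Fin 3) ℝ}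
    (hg : ∀ i j, ContDiffAt ℝ ∞ (fun y => g y i j) 0)
    (hg' : ∀ i j, ContDiffAt ℝ ∞ (fun y => g' y i j) 0) (l i j : Fin 3) :
    ∀ᶠ y in 𝓝 0, christoffelFirst (metricDiff g g') l i j y
      = christoffelFirst (fun a b z => g z a b) l i j y
        - christoffelFirst (fun a b z => g' z a b) l i j y := by
  filter_upwards [pd_sub (hg l j) (hg' l j) i, pd_sub (hg l i) (hg' l i) j,
    pd_sub (hg i j) (hg' i j) l] with y h1 h2 h3
  change pd i (fun z => g z l j - g' z l j) y + pd j (fun z => g z l i - g' z l i) y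
    - pd l (fun z => g z i j - g' z i j) y = _
  rw [h1, h2, h3, christoffelFirst, christoffelFirst]
  ring

namespace SmoothMetric

variable {g : E3 → Matrix (Fin 3) (Fin 3) ℝ}

theorem smooth_inv (h : SmoothMetric g) (i j : Fin 3) :
    ContDiffAt ℝ ∞ (fun y => (g y)⁻¹ i j) 0 :=
  (contDiffAt_inv_apply (M := g 0) h.det_ne i j).comp 0
    (contDiffAt_pi.2 fun a => contDiffAt_pi.2 fun b => h.smooth a b)

theorem eventually_isUnit_det (h : SmoothMetric g) : ∀ᶠ y in 𝓝 0, IsUnit (g y).det := by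
  have hg : ContinuousAt g 0 :=
    continuousAt_pi.2 fun i => continuousAt_pi.2 fun j => (h.smooth i j).continuousAt
  have hdet : ContinuousAt (fun y => (g y).det) 0 :=
    (continuous_id.matrix_det.continuousAt (x := g 0)).comp hg
  exact (hdet.eventually_ne h.det_ne).mono fun y hy => isUnit_iff_ne_zero.2 hy

theorem smooth_christoffel (h : SmoothMetric g) (i j k : Fin 3) :
    ContDiffAt ℝ ∞ (christoffel g i j k) 0 :=
  contDiffAt_const.mul (ContDiffAt.sum fun l _ => (h.smooth_inv i l).mul
    (contDiffAt_christoffelFirst h.smooth l j k))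

theorem smooth_iterCovDeriv (h : SmoothMetric g) {φ : E3 → ℝ} (hφ : ContDiffAt ℝ ∞ φ 0) :
    ∀ (p : ℕ) (a : Fin p → Fin 3), ContDiffAt ℝ ∞ (fun y => iterCovDeriv g φ p y a) 0
  | 0, _ => hφ
  | p + 1, a => (contDiffAt_pd (h.smooth_iterCovDeriv hφ p (Fin.tail a)) (a 0)).sub
      (ContDiffAt.sum fun i _ => ContDiffAt.sum fun l _ =>
        (h.smooth_christoffel l (a 0) (Fin.tail a i)).mul (h.smooth_iterCovDeriv hφ p _))

theorem vanishesTo_inv_add_one (h : SmoothMetric g) (h0 : g 0 = -1) (i j : Fin 3) :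
    VanishesTo 1 fun y => (g y)⁻¹ i j + if i = j then 1 else 0 := by
  have hinv : (-1 : Matrix (Fin 3) (Fin 3) ℝ)⁻¹ = -1 := Matrix.inv_eq_left_inv (by simp)
  refine VanishesTo.one_iff.2 ⟨(h.smooth_inv i j).add contDiffAt_const, ?_⟩
  rw [h0, hinv, Matrix.neg_apply, Matrix.one_apply, neg_add_cancel]

end SmoothMetric

namespace MetricJetEq

variable {m : ℕ} {g g' : E3 → Matrix (Fin 3) (Fin 3) ℝ}

theorem mono {k : ℕ} (h : MetricJetEq m g g') (hk : k ≤ m) : MetricJetEq k g g' :=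
  ⟨h.left, h.right, fun i j => (h.jetEq i j).mono hk⟩

theorem vanishesTo_metricDiff (h : MetricJetEq m g g') (i j : Fin 3) :
    VanishesTo m (metricDiff g g' i j) :=
  (h.jetEq i j).sub_vanishesTo

theorem jetEq_inv (h : MetricJetEq m g g') (i j : Fin 3) :
    JetEq m (fun y => (g y)⁻¹ i j) fun y => (g' y)⁻¹ i j :=
  (JetEq.pi fun a => JetEq.pi fun b => h.jetEq a b).comp (contDiffAt_inv_apply h.left.det_ne i j)
    (contDiffAt_inv_apply h.right.det_ne i j)

/-- At the metric `-δ` the Christoffel symbols have the derivative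
`k ↦ -(1/2) (∂_j k_ic + ∂_c k_ij - ∂_i k_jc)`. -/
theorem christoffel_sub (h : MetricJetEq (m + 1) g g') (h0 : g' 0 = -1) (i j c : Fin 3) :
    VanishesTo (m + 1) fun y => christoffel g i j c y - christoffel g' i j c y
      + (1 / 2) * christoffelFirst (metricDiff g g') i j c y := by
  have hF (l : Fin 3) : VanishesTo m (christoffelFirst (metricDiff g g') l j c) :=
    (((h.vanishesTo_metricDiff l c).pd j).add ((h.vanishesTo_metricDiff l j).pd c)).sub
      ((h.vanishesTo_metricDiff j c).pd l)
  have key : VanishesTo (m + 1) fun y => (1 / 2) * ∑ l,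
      (((g y)⁻¹ i l - (g' y)⁻¹ i l) * christoffelFirst (fun a b z => g z a b) l j c y
        + ((g' y)⁻¹ i l + if i = l then 1 else 0) * christoffelFirst (metricDiff g g') l j c y) :=
    .const_mul _ <| .sum fun l _ => ((h.jetEq_inv i l).sub_vanishesTo.mul
      (.of_smooth (contDiffAt_christoffelFirst h.left.smooth l j c)) le_rfl).add
      ((h.right.vanishesTo_inv_add_one h0 i l).mul (hF l) (by omega))
  refine key.congr ?_
  filter_upwards [Filter.eventually_all.2 fun l =>
    christoffelFirst_metricDiff h.left.smooth h.right.smooth l j c] with y hlin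
  have hi : christoffelFirst (metricDiff g g') i j c y
      = ∑ l, (if i = l then 1 else 0) * christoffelFirst (metricDiff g g') l j c y := by simp
  rw [hi]
  change _ = (1 / 2) * (∑ l, (g y)⁻¹ i l * christoffelFirst (fun a b z => g z a b) l j c y)
    - (1 / 2) * (∑ l, (g' y)⁻¹ i l * christoffelFirst (fun a b z => g' z a b) l j c y) + _
  rw [← mul_sub, ← mul_add, ← Finset.sum_sub_distrib, ← Finset.sum_add_distrib]
  refine congrArg _ (Finset.sum_congr rfl fun l _ => ?_)
  rw [hlin]
  ring

theorem jetEq_christoffel (h : MetricJetEq (m + 1) g g') (i j k : Fin 3) :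
    JetEq m (christoffel g i j k) (christoffel g' i j k) := by
  have hF (l : Fin 3) : JetEq m (christoffelFirst (fun a b z => g z a b) l j k)
      (christoffelFirst (fun a b z => g' z a b) l j k) :=
    (((h.jetEq l k).pd j).add ((h.jetEq l j).pd k)).sub ((h.jetEq j k).pd l)
  exact (JetEq.sum fun l _ => ((h.jetEq_inv i l).mono m.le_succ).mul (hF l)).const_mul (1 / 2)

theorem pd_christoffel_sub (h : MetricJetEq (m + 1) g g') (h0 : g' 0 = -1) (d i j c : Fin 3) :
    VanishesTo m fun y => pd d (christoffel g i j c) y - pd d (christoffel g' i j c) y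
      + (1 / 2) * (hess (metricDiff g g') y d j i c + hess (metricDiff g g') y d c i j
        - hess (metricDiff g g') y d i j c) := by
  have hk (i j : Fin 3) := (h.vanishesTo_metricDiff i j).smooth
  have hF := contDiffAt_christoffelFirst hk i j c
  have hΓ := h.left.smooth_christoffel i j c
  have hΓ' := h.right.smooth_christoffel i j c
  refine ((h.christoffel_sub h0 i j c).pd d).congr ?_
  filter_upwards [pd_add (hΓ.sub hΓ') ((contDiffAt_const (c := (1 / 2 : ℝ))).mul hF) d,
    pd_sub hΓ hΓ' d, pd_const_mul (1 / 2) hF d, pd_christoffelFirst hk d i j c] with y h1 h2 h3 h4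
  rw [h1, h2, h3, h4]

/-- At the metric `-δ` the Ricci tensor has the derivative `-linRicci`. -/
theorem ricci_sub (h : MetricJetEq (m + 1) g g') (h0 : g' 0 = -1)
    (hs : ∀ i j, metricDiff g g' i j = metricDiff g g' j i) (i j : Fin 3) :
    VanishesTo m fun y => ricci g i j y - ricci g' i j y
      + linRicci (hess (metricDiff g g') y) i j := by
  have hΓ := h.jetEq_christoffel
  have hd := h.pd_christoffel_sub h0
  have key := VanishesTo.sum (s := Finset.univ) fun l _ => ((hd l l i j).sub (hd j l i l)).add
    (VanishesTo.sum (s := Finset.univ) fun k _ =>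
      (((hΓ l l k).mul (hΓ k i j)).sub ((hΓ l j k).mul (hΓ k i l))).sub_vanishesTo)
  refine key.congr (.of_forall fun y => ?_)
  simp only [ricci, linRicci, hess]
  rw [Finset.mul_sum, ← Finset.sum_sub_distrib, ← Finset.sum_add_distrib]
  refine Finset.sum_congr rfl fun l _ => ?_
  rw [hs l i, hs l j]
  simp only [Finset.sum_sub_distrib]
  ring

theorem iterCovDeriv_sub {p : ℕ} (h : MetricJetEq p g g') {φ φ' : E3 → ℝ} (hφ : JetEq p φ φ') :
    ∀ (q r : ℕ), q + r = p + 1 → ∀ a : Fin q → Fin 3,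
    VanishesTo r fun y => iterCovDeriv g φ q y a - iterCovDeriv g' φ' q y a
      - pds (List.ofFn a) (fun z => φ z - φ' z) y
  | 0, r, _, a => by
    simpa [iterCovDeriv, pds] using VanishesTo.zero
  | q + 1, r, hqr, a => by
    have hD := h.left.smooth_iterCovDeriv hφ.left q
    have hD' := h.right.smooth_iterCovDeriv hφ.right q
    have ih := h.iterCovDeriv_sub hφ q (r + 1) (by omega)
    have hT (b : Fin q → Fin 3) :
        JetEq r (fun y => iterCovDeriv g φ q y b) fun y => iterCovDeriv g' φ' q y b := by
      have hpds : VanishesTo r (pds (List.ofFn b) fun z => φ z - φ' z) :=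
        .pds (hφ.sub_vanishesTo.mono (by rw [List.length_ofFn]; omega))
      exact (JetEq.iff_vanishesTo_sub (hD b) (hD' b)).2 <| by
        simpa using ((ih b).mono r.le_succ).add hpds
    have hconn : VanishesTo r fun y => ∑ i, ∑ l,
        (christoffel g l (a 0) (Fin.tail a i) y
            * iterCovDeriv g φ q y (Function.update (Fin.tail a) i l)
          - christoffel g' l (a 0) (Fin.tail a i) y
            * iterCovDeriv g' φ' q y (Function.update (Fin.tail a) i l)) :=
      .sum fun i _ => .sum fun l _ => by
        have hr : r + 1 ≤ p := by have := i.pos; omega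
        exact ((MetricJetEq.jetEq_christoffel (h.mono hr) l (a 0) (Fin.tail a i)).mul
          (hT _)).sub_vanishesTo
    refine (((ih (Fin.tail a)).pd (a 0)).sub hconn).congr ?_
    filter_upwards [pd_sub ((hD (Fin.tail a)).sub (hD' (Fin.tail a)))
      (contDiffAt_pds hφ.sub_vanishesTo.smooth (List.ofFn (Fin.tail a))) (a 0),
      pd_sub (hD (Fin.tail a)) (hD' (Fin.tail a)) (a 0)] with y h1 h2
    rw [h1, h2]
    simp only [iterCovDeriv, covDeriv, List.ofFn_succ, Finset.sum_sub_distrib, pds,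
      List.foldr_cons, Fin.tail_def]
    ring

end MetricJetEq

theorem exists_perm_ofFn_update {ι : Type*} {p : ℕ} {i j : Fin p} (hij : i ≠ j)
    (a : Fin p → ι) : ∃ l : List ι, ∀ k,
      (List.ofFn (Function.update (Function.update a i k) j k)).Perm (l ++ [k, k]) := by
  set s : Multiset (Fin p) := (Finset.univ.val.erase i).erase j
  have hs : Finset.univ.val = i ::ₘ j ::ₘ s := by
    rw [Multiset.cons_erase, Multiset.cons_erase (Finset.mem_univ_val i)]
    exact (Multiset.mem_erase_of_ne hij.symm).2 (Finset.mem_univ_val j)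
  have hnodup : (i ::ₘ j ::ₘ s).Nodup := hs ▸ Finset.univ.nodup
  refine ⟨(s.map a).toList, fun k => Multiset.coe_eq_coe.1 ?_⟩
  have hmap : s.map (Function.update (Function.update a i k) j k) = s.map a := by
    refine Multiset.map_congr rfl fun t ht => ?_
    simp only [Multiset.nodup_cons, Multiset.mem_cons, not_or] at hnodup
    rw [Function.update_of_ne (by rintro rfl; exact hnodup.2.1 ht),
      Function.update_of_ne (by rintro rfl; exact hnodup.1.2 ht)]
  rw [← Fin.univ_val_map, hs, Multiset.map_cons, Multiset.map_cons, hmap,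
    Function.update_of_ne hij, Function.update_self, Function.update_self, ← Multiset.coe_add,
    Multiset.coe_toList, add_comm]
  rfl

theorem pds_mem_stf {u : E3 → ℝ} (hu : ContDiffAt ℝ ∞ u 0) {p : ℕ}
    (hL : ∀ q, p = q + 2 → VanishesTo (q + 1) fun y => ∑ k, pd k (pd k u) y) :
    WithLp.toLp 2 (fun a : Fin p → Fin 3 => pds (List.ofFn a) u 0) ∈ stf p := by
  refine ⟨fun σ a => (pds_perm hu (Equiv.Perm.ofFn_comp_perm σ a)).self_of_nhds,
    fun i j hij a => ?_⟩
  obtain ⟨l, hl⟩ := exists_perm_ofFn_update hij a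
  have hlen : p = l.length + 2 := by simpa using (hl 0).length_eq
  have htrace : VanishesTo 1 (pds l fun y => ∑ k, pds [k, k] u y) :=
    .pds (m := 1) ((hL l.length hlen).mono (by omega))
  calc ∑ k, pds (List.ofFn (Function.update (Function.update a i k) j k)) u 0
    _ = ∑ k, pds l (pds [k, k] u) 0 := Finset.sum_congr rfl fun k _ => by
      rw [(pds_perm hu (hl k)).self_of_nhds, pds_append]
    _ = 0 := (pds_sum (fun k _ => contDiffAt_pds hu [k, k]) l).self_of_nhds.symm.trans
      htrace.eq_zero

theorem pd_add_const (f : E3 → ℝ) (c : ℝ) (i : Fin 3) : pd i (fun y => f y + c) = pd i f :=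
  funext fun y => by rw [pd, fderiv_add_const, pd]

theorem sum_mul_christoffel {g : E3 → Matrix (Fin 3) (Fin 3) ℝ} {y : E3}
    (hy : IsUnit (g y).det) (l j k : Fin 3) :
    2 * ∑ i, g y l i * christoffel g i j k y = christoffelFirst (fun a b z => g z a b) l j k y := by
  have hinv (r : Fin 3) : ∑ i, g y l i * (g y)⁻¹ i r = if l = r then 1 else 0 := by
    rw [← Matrix.mul_apply, Matrix.mul_nonsing_inv _ hy, Matrix.one_apply]
  calc 2 * ∑ i, g y l i * christoffel g i j k y
    _ = ∑ i, ∑ r, g y l i * (g y)⁻¹ i r * christoffelFirst (fun a b z => g z a b) r j k y := by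
      simp only [christoffel, christoffelFirst, Finset.mul_sum]
      exact Finset.sum_congr rfl fun i _ => Finset.sum_congr rfl fun r _ => by ring
    _ = _ := by
      rw [Finset.sum_comm]
      simp [← Finset.sum_mul, hinv]

theorem SmoothMetric.hasRadialGeodesics {g : E3 → Matrix (Fin 3) (Fin 3) ℝ} (h : SmoothMetric g)
    (hn : ∀ᶠ y in 𝓝 0, ∀ i, ∑ j, ∑ k, christoffel g i j k y * y j * y k = 0) :
    HasRadialGeodesics fun i j y => g y i j := by
  filter_upwards [hn, h.eventually_isUnit_det] with y hn hy l
  calc ∑ j, ∑ k, christoffelFirst (fun a b z => g z a b) l j k y * y j * y k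
    _ = 2 * ∑ i, g y l i * ∑ j, ∑ k, christoffel g i j k y * y j * y k := by
      simp only [← sum_mul_christoffel hy, Fin.sum_univ_three]
      ring
    _ = 0 := by simp [hn]

theorem SmoothMetric.vanishesTo_radial {g : E3 → Matrix (Fin 3) (Fin 3) ℝ} (h : SmoothMetric g)
    (h0 : g 0 = -1) (hs : ∀ y i j, g y i j = g y j i)
    (hn : ∀ᶠ y in 𝓝 0, ∀ i, ∑ j, ∑ k, christoffel g i j k y * y j * y k = 0)
    (m : ℕ) (l : Fin 3) : VanishesTo m (radial fun k y => g y l k + if l = k then 1 else 0) := by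
  refine HasRadialGeodesics.vanishesTo_radial (G := fun i j y => g y i j + if i = j then 1 else 0)
    ?_ (fun i j => VanishesTo.one_iff.2 ⟨(h.smooth i j).add contDiffAt_const, ?_⟩)
    (fun i j => funext fun y => by simp only [hs y i j, eq_comm]) m l
  · simpa only [HasRadialGeodesics, christoffelFirst, pd_add_const] using h.hasRadialGeodesics hn
  · simp [h0, Matrix.one_apply]

/-- At the metric `-δ` the Laplacian has the derivative `-∑ ∂_k ∂_k` in the function. -/
theorem MetricJetEq.laplacian_sub {g g' : E3 → Matrix (Fin 3) (Fin 3) ℝ} {φ φ' : E3 → ℝ} {q : ℕ}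
    (h : MetricJetEq (q + 2) g g') (h0 : g' 0 = -1) (hφ : JetEq (q + 2) φ φ') :
    VanishesTo (q + 1) fun y => laplacian g φ y - laplacian g' φ' y
      + ∑ k, pd k (pd k fun z => φ z - φ' z) y := by
  have hu (i j : Fin 3) : VanishesTo q (pds (List.ofFn ![i, j]) fun z => φ z - φ' z) :=
    (hφ.sub_vanishesTo.pd j).pd i
  have key := VanishesTo.sum (m := q + 1) (s := Finset.univ) fun i _ =>
    VanishesTo.sum (s := Finset.univ) fun j _ =>
      (((h.jetEq_inv i j).sub_vanishesTo.mul
        (.of_smooth (h.left.smooth_iterCovDeriv hφ.left 2 ![i, j])) (by omega)).add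
      ((VanishesTo.of_smooth (h.right.smooth_inv i j)).mul
        (h.iterCovDeriv_sub hφ 2 (q + 1) (by omega) ![i, j]) (by omega))).add
      ((h.right.vanishesTo_inv_add_one h0 i j).mul (hu i j) (by omega))
  refine key.congr (.of_forall fun y => ?_)
  have htrace (k : Fin 3) : pd k (pd k fun z => φ z - φ' z) y
      = ∑ j, (if k = j then 1 else 0) * pds (List.ofFn ![k, j]) (fun z => φ z - φ' z) y := by
    simp [pds]
  simp only [laplacian, htrace, ← Finset.sum_sub_distrib, ← Finset.sum_add_distrib]
  exact Finset.sum_congr rfl fun i _ => Finset.sum_congr rfl fun j _ => by ring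

/-! ### Jets of solutions at the base point -/

/-- The arguments `(φ, Dφ)` of the coefficient functions `f` and `f^α`. -/
def fieldArg {n : ℕ} (φ : Fin n → E3 → ℝ) (e : Fin 3 → Fin 3 → E3 → ℝ) (y : E3) :
    (Fin n → ℝ) × (Fin n → Fin 3 → ℝ) :=
  (fun γ => φ γ y, fun γ a => ∑ i, e i a y * pd i (φ γ) y)

/-- The germ at the origin of a solution of the field equations in normal coordinates: a metric `g`,
fields `φ` and a normal frame with components `e i a`. -/
structure IsSolutionGerm {n : ℕ} (S : FieldSystem n) (g : E3 → Matrix (Fin 3) (Fin 3) ℝ)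
    (φ : Fin n → E3 → ℝ) (e : Fin 3 → Fin 3 → E3 → ℝ) : Prop where
  smooth_g : ∀ i j, ContDiffAt ℝ ∞ (fun y => g y i j) 0
  smooth_φ : ∀ α, ContDiffAt ℝ ∞ (φ α) 0
  smooth_e : ∀ i a, ContDiffAt ℝ ∞ (e i a) 0
  symm : ∀ y i j, g y i j = g y j i
  g_zero : g 0 = -1
  e_zero : ∀ i a, e i a 0 = if i = a then 1 else 0
  normal : ∀ᶠ y in 𝓝 0, ∀ i, ∑ j, ∑ k, christoffel g i j k y * y j * y k = 0
  parallel : ∀ᶠ y in 𝓝 0, ∀ i a,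
    ∑ j, y j * (pd j (e i a) y + ∑ k, christoffel g i j k y * e k a y) = 0
  mem_domF : ∀ᶠ y in 𝓝 0, (fun γ => φ γ y) ∈ S.domF
  mem_domf : ∀ᶠ y in 𝓝 0, fieldArg φ e y ∈ S.domf
  eq_laplacian : ∀ᶠ y in 𝓝 0, ∀ α, laplacian g (φ α) y = S.f1 α (fieldArg φ e y)
  eq_ricci : ∀ᶠ y in 𝓝 0, ∀ i j, ricci g i j y
    = ∑ α, S.F1 α (fun γ => φ γ y) * iterCovDeriv g (φ α) 2 y ![i, j]
      + ∑ α, ∑ β, S.F2 α β (fun γ => φ γ y) * pd i (φ α) y * pd j (φ β) y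
      + S.f0 (fieldArg φ e y) * g y i j

namespace IsSolutionGerm

variable {n : ℕ} {S : FieldSystem n} {g g' : E3 → Matrix (Fin 3) (Fin 3) ℝ}
  {φ φ' : Fin n → E3 → ℝ} {e e' : Fin 3 → Fin 3 → E3 → ℝ}

theorem smoothMetric (h : IsSolutionGerm S g φ e) : SmoothMetric g :=
  ⟨h.smooth_g, by rw [h.g_zero, Matrix.det_neg]; simp⟩

theorem vanishesTo_radial_metricDiff (h : IsSolutionGerm S g φ e) (h' : IsSolutionGerm S g' φ' e')
    (m : ℕ) (l : Fin 3) : VanishesTo m (radial (metricDiff g g' l)) := by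
  refine ((h.smoothMetric.vanishesTo_radial h.g_zero h.symm h.normal m l).sub
    (h'.smoothMetric.vanishesTo_radial h'.g_zero h'.symm h'.normal m l)).congr
    (.of_forall fun y => ?_)
  simp only [radial, metricDiff, ← Finset.sum_sub_distrib]
  exact Finset.sum_congr rfl fun k _ => by ring

theorem jetEq_comp_fieldArg (h : IsSolutionGerm S g φ e) (h' : IsSolutionGerm S g' φ' e') {m : ℕ}
    (hφ : ∀ α, JetEq (m + 1) (φ α) (φ' α)) (he : ∀ i a, JetEq m (e i a) (e' i a))
    {F : (Fin n → ℝ) × (Fin n → Fin 3 → ℝ) → ℝ} (hF : AnalyticOnNhd ℝ F S.domf) :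
    JetEq m (fun y => F (fieldArg φ e y)) fun y => F (fieldArg φ' e' y) :=
  JetEq.comp (f := fieldArg φ e) (g := fieldArg φ' e')
    ((JetEq.pi fun γ => (hφ γ).mono m.le_succ).prodMk
      (.pi fun γ => .pi fun a => .sum fun i _ => (he i a).mul ((hφ γ).pd i)))
    (hF _ h.mem_domf.self_of_nhds).contDiffAt (hF _ h'.mem_domf.self_of_nhds).contDiffAt

theorem jetEq_comp_fields (h : IsSolutionGerm S g φ e) (h' : IsSolutionGerm S g' φ' e') {m : ℕ}
    (hφ : ∀ α, JetEq m (φ α) (φ' α)) {F : (Fin n → ℝ) → ℝ} (hF : AnalyticOnNhd ℝ F S.domF) :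
    JetEq m (fun y => F fun γ => φ γ y) fun y => F fun γ => φ' γ y :=
  (JetEq.pi hφ).comp (hF _ h.mem_domF.self_of_nhds).contDiffAt
    (hF _ h'.mem_domF.self_of_nhds).contDiffAt

theorem vanishesTo_sum_pd_pd (h : IsSolutionGerm S g φ e) (h' : IsSolutionGerm S g' φ' e') {q : ℕ}
    (hg : MetricJetEq (q + 2) g g') (hφ : ∀ α, JetEq (q + 2) (φ α) (φ' α))
    (he : ∀ i a, JetEq (q + 2) (e i a) (e' i a)) (α : Fin n) :
    VanishesTo (q + 1) fun y => ∑ k, pd k (pd k fun z => φ α z - φ' α z) y := by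
  have hf := h.jetEq_comp_fieldArg h' hφ (fun i a => (he i a).mono (Nat.le_succ _))
    (S.analytic_f1 α)
  refine ((hg.laplacian_sub h'.g_zero (hφ α)).sub hf.sub_vanishesTo).congr ?_
  filter_upwards [h.eq_laplacian, h'.eq_laplacian] with y h1 h2
  rw [h1 α, h2 α, add_sub_cancel_left]

theorem jetEq_ricci (h : IsSolutionGerm S g φ e) (h' : IsSolutionGerm S g' φ' e') {q : ℕ}
    (hg : MetricJetEq (q + 1) g g') (hφ : ∀ α, JetEq (q + 2) (φ α) (φ' α))
    (he : ∀ i a, JetEq (q + 1) (e i a) (e' i a)) (i j : Fin 3) :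
    JetEq q (ricci g i j) (ricci g' i j) := by
  have hφ1 (α : Fin n) : JetEq (q + 1) (φ α) (φ' α) := (hφ α).mono (Nat.le_succ _)
  have hφ0 (α : Fin n) : JetEq q (φ α) (φ' α) := (hφ α).mono (by omega)
  have hD (α : Fin n) : JetEq q (fun y => iterCovDeriv g (φ α) 2 y ![i, j])
      fun y => iterCovDeriv g' (φ' α) 2 y ![i, j] := by
    refine (JetEq.iff_vanishesTo_sub (hg.left.smooth_iterCovDeriv (h.smooth_φ α) 2 _)
      (hg.right.smooth_iterCovDeriv (h'.smooth_φ α) 2 _)).2 ?_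
    have hu : VanishesTo q (pds (List.ofFn ![i, j]) fun z => φ α z - φ' α z) :=
      ((hφ α).sub_vanishesTo.pd j).pd i
    simpa using (hg.iterCovDeriv_sub (hφ1 α) 2 q (by omega) ![i, j]).add hu
  have hF1 := JetEq.sum (s := Finset.univ) fun α _ =>
    (h.jetEq_comp_fields h' hφ0 (S.analytic_F1 α)).mul (hD α)
  have hF2 := JetEq.sum (s := Finset.univ) fun α _ => JetEq.sum (s := Finset.univ) fun β _ =>
    ((h.jetEq_comp_fields h' hφ0 (S.analytic_F2 α β)).mul ((hφ1 α).pd i)).mul ((hφ1 β).pd j)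
  have hf0 := (h.jetEq_comp_fieldArg h' hφ1 (fun i a => (he i a).mono q.le_succ)
    S.analytic_f0).mul ((hg.jetEq i j).mono q.le_succ)
  refine ((hF1.add hF2).add hf0).congr ?_ ?_
  · filter_upwards [h.eq_ricci] with y hy using (hy i j).symm
  · filter_upwards [h'.eq_ricci] with y hy using (hy i j).symm

theorem metricJetEq_succ (h : IsSolutionGerm S g φ e) (h' : IsSolutionGerm S g' φ' e') {q : ℕ}
    (hg : MetricJetEq (q + 1) g g') (hφ : ∀ α, JetEq (q + 2) (φ α) (φ' α))
    (he : ∀ i a, JetEq (q + 1) (e i a) (e' i a)) : MetricJetEq (q + 2) g g' := by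
  have hs (i j : Fin 3) : metricDiff g g' i j = metricDiff g g' j i :=
    funext fun y => by rw [metricDiff, metricDiff, h.symm, h'.symm]
  refine ⟨hg.left, hg.right, fun i j =>
    (JetEq.iff_vanishesTo_sub (h.smooth_g i j) (h'.smooth_g i j)).2 ?_⟩
  refine vanishesTo_of_linRicci (k := metricDiff g g')
    (fun i j => (hg.vanishesTo_metricDiff i j).mono (by omega)) hs
    (h.vanishesTo_radial_metricDiff h') (fun i j => ?_) i j
  simpa using (hg.ricci_sub h'.g_zero hs i j).sub (h.jetEq_ricci h' hg hφ he i j).sub_vanishesTo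

theorem jetEq_frame (h : IsSolutionGerm S g φ e) (h' : IsSolutionGerm S g' φ' e') {q : ℕ}
    (hg : MetricJetEq (q + 1) g g') : ∀ r ≤ q + 1, ∀ i a, JetEq r (e i a) (e' i a)
  | 0, _, i, a => .of_smooth (h.smooth_e i a) (h'.smooth_e i a)
  | r + 1, hr, i, a => by
    have ih := h.jetEq_frame h' hg r (by omega)
    have htransport := (JetEq.sum (s := Finset.univ) fun j _ => JetEq.coord_mul
      (JetEq.sum (s := Finset.univ) fun k _ =>
        ((hg.jetEq_christoffel i j k).mono (by omega : r ≤ q)).mul (ih k a)) j).sub_vanishesTo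
    have hsm := (h.smooth_e i a).sub (h'.smooth_e i a)
    refine (JetEq.iff_vanishesTo_sub (h.smooth_e i a) (h'.smooth_e i a)).2 ?_
    refine .of_euler (c := 0) (m := 1) (by norm_num)
      (VanishesTo.one_iff.2 ⟨hsm, by rw [h.e_zero, h'.e_zero, sub_self]⟩)
      ((htransport.const_mul (-1)).congr ?_)
    filter_upwards [h.parallel, h'.parallel, Filter.eventually_all.2 fun l =>
      pd_sub (h.smooth_e i a) (h'.smooth_e i a) l] with y h1 h2 hp
    have h1 := h1 i a
    have h2 := h2 i a
    simp only [mul_add, Finset.sum_add_distrib] at h1 h2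
    simp only [euler_eq_radial_pd, radial, hp, mul_sub, Finset.sum_sub_distrib, zero_smul, add_zero]
    linarith

/-- In the induction step the field equation for `φ` leaves only the symmetric trace-free part of
the derivatives of `φ` of the next order free; the second field equation then fixes the metric, and
parallel transport fixes the frame. -/
theorem jetEq (h : IsSolutionGerm S g φ e) (h' : IsSolutionGerm S g' φ' e')
    (hnull : ∀ α p, WithLp.toLp 2 (fun a : Fin p → Fin 3 => iterCovDeriv g (φ α) p 0 a
        - iterCovDeriv g' (φ' α) p 0 a) ∈ stf p →
      ∀ a, iterCovDeriv g (φ α) p 0 a = iterCovDeriv g' (φ' α) p 0 a) (p : ℕ) :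
    MetricJetEq p g g' ∧ (∀ α, JetEq p (φ α) (φ' α)) ∧ ∀ i a, JetEq p (e i a) (e' i a) := by
  induction p with
  | zero => exact ⟨⟨h.smoothMetric, h'.smoothMetric, fun i j =>
      .of_smooth (h.smooth_g i j) (h'.smooth_g i j)⟩,
      fun α => .of_smooth (h.smooth_φ α) (h'.smooth_φ α),
      fun i a => .of_smooth (h.smooth_e i a) (h'.smooth_e i a)⟩
  | succ p ih =>
    obtain ⟨hg, hφ, he⟩ := ih
    have hφ' (α : Fin n) : JetEq (p + 1) (φ α) (φ' α) := by
      have hu := (hφ α).sub_vanishesTo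
      have hD (a : Fin p → Fin 3) : iterCovDeriv g (φ α) p 0 a - iterCovDeriv g' (φ' α) p 0 a
          = pds (List.ofFn a) (fun z => φ α z - φ' α z) 0 :=
        sub_eq_zero.1 (hg.iterCovDeriv_sub (hφ α) p 1 rfl a).eq_zero
      have heq := hnull α p <| by
        simp only [hD]
        refine pds_mem_stf hu.smooth fun q hq => ?_
        subst hq
        exact h.vanishesTo_sum_pd_pd h' hg hφ he α
      refine (JetEq.iff_vanishesTo_sub (h.smooth_φ α) (h'.smooth_φ α)).2
        (hu.succ_of_pds fun l hl => ?_)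
      subst hl
      have hl := hD l.get
      rwa [heq, sub_self, List.ofFn_get, eq_comm] at hl
    have hg' : MetricJetEq (p + 1) g g' := by
      cases p with
      | zero => exact ⟨hg.left, hg.right, fun i j => (JetEq.iff_vanishesTo_sub (h.smooth_g i j)
          (h'.smooth_g i j)).2 (VanishesTo.one_iff.2 ⟨(hg.vanishesTo_metricDiff i j).smooth,
            by rw [h.g_zero, h'.g_zero, sub_self]⟩)⟩
      | succ q => exact h.metricJetEq_succ h' hg hφ' he
    exact ⟨hg', hφ', h.jetEq_frame h' hg' (p + 1) le_rfl⟩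

end IsSolutionGerm

theorem MetricJetEq.iterCovDeriv_eq {g g' : E3 → Matrix (Fin 3) (Fin 3) ℝ} {φ φ' : E3 → ℝ} {p : ℕ}
    (h : MetricJetEq p g g') (hφ : JetEq (p + 1) φ φ') (a : Fin p → Fin 3) :
    iterCovDeriv g φ p 0 a = iterCovDeriv g' φ' p 0 a := by
  have hpds : VanishesTo 1 (pds (List.ofFn a) fun z => φ z - φ' z) :=
    .pds (hφ.sub_vanishesTo.mono (by rw [List.length_ofFn]; omega))
  have hD := (h.iterCovDeriv_sub (hφ.mono p.le_succ) p 1 rfl a).eq_zero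
  rwa [hpds.eq_zero, sub_zero, sub_eq_zero] at hD

/-! ### Symmetric trace-free tensors and rotations -/

section Updates

variable {ι K M : Type*} [DecidableEq ι]

theorem update_update_comp_swap {j k : ι} (hjk : j ≠ k) (a : ι → K) (u v : K) :
    Function.update (Function.update a j u) k v ∘ Equiv.swap j k
      = Function.update (Function.update a j v) k u := by
  funext m
  simp only [Function.comp_apply, Function.update_apply, Equiv.swap_apply_def]
  split_ifs <;> simp_all

variable [Fintype ι]

theorem sum_update_swap [Fintype K] [AddCommMonoid M] (j : ι) (H : (ι → K) → K → M) :
    ∑ a, ∑ u, H a u = ∑ a, ∑ u, H (Function.update a j u) (a j) := by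
  rw [← Fintype.sum_prod_type', ← Fintype.sum_prod_type']
  have hf : Function.Involutive fun x : (ι → K) × K => (Function.update x.1 j x.2, x.1 j) :=
    fun x => by simp
  exact (Fintype.sum_equiv hf.toPerm (fun x => H (Function.update x.1 j x.2) (x.1 j))
    (fun x => H x.1 x.2) fun x => rfl).symm

theorem sum_sum_update [Fintype K] [AddCommMonoid M] (j : ι) (G : (ι → K) → M) :
    ∑ a, ∑ u, G (Function.update a j u) = Fintype.card K • ∑ a, G a := by
  rw [← sum_update_swap j fun a _ => G a]
  simp [Finset.sum_nsmul]

theorem prod_eq_mul_mul_prod_erase_erase [CommMonoid M] {j k : ι} (hjk : j ≠ k) (G : ι → M) :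
    ∏ m, G m = G j * G k * ∏ m ∈ (Finset.univ.erase j).erase k, G m := by
  rw [← Finset.mul_prod_erase _ _ (Finset.mem_univ j),
    ← Finset.mul_prod_erase _ _ (Finset.mem_erase.2 ⟨hjk.symm, Finset.mem_univ k⟩), ← mul_assoc]

theorem prod_erase_erase_update_update [CommMonoid M] (j k : ι) (a : ι → K) (u v : K)
    (G : ι → K → M) :
    ∏ m ∈ (Finset.univ.erase j).erase k,
        G m (Function.update (Function.update a j u) k v m)
      = ∏ m ∈ (Finset.univ.erase j).erase k, G m (a m) := by
  refine Finset.prod_congr rfl fun m hm => ?_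
  simp only [Finset.mem_erase] at hm
  rw [Function.update_of_ne hm.1, Function.update_of_ne hm.2.1]

theorem sum_mul_prod_erase_erase_congr [Fintype K] [Field M] [CharZero M] {j k : ι} (hjk : j ≠ k)
    {c c' : K → K → M} (G : ι → K → M) {T : (ι → K) → M}
    (h : ∀ a, ∑ u, ∑ v, c u v * T (Function.update (Function.update a j u) k v)
      = ∑ u, ∑ v, c' u v * T (Function.update (Function.update a j u) k v)) :
    ∑ a, c (a j) (a k) * (∏ m ∈ (Finset.univ.erase j).erase k, G m (a m)) * T a
      = ∑ a, c' (a j) (a k) * (∏ m ∈ (Finset.univ.erase j).erase k, G m (a m)) * T a := by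
  rcases isEmpty_or_nonempty K with hK | hK
  · exact Finset.sum_congr rfl fun a _ => (hK.false (a j)).elim
  have hsum (d : K → K → M) : Fintype.card K • Fintype.card K •
      ∑ a, d (a j) (a k) * (∏ m ∈ (Finset.univ.erase j).erase k, G m (a m)) * T a
      = ∑ a : ι → K, (∏ m ∈ (Finset.univ.erase j).erase k, G m (a m))
        * ∑ u, ∑ v, d u v * T (Function.update (Function.update a j u) k v) := by
    rw [← sum_sum_update k, ← sum_sum_update j]
    refine Finset.sum_congr rfl fun a _ => ?_
    simp only [Finset.mul_sum, prod_erase_erase_update_update, Function.update_self,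
      Function.update_of_ne hjk]
    exact Finset.sum_congr rfl fun u _ => Finset.sum_congr rfl fun v _ => by ring
  have hcard : Fintype.card K ≠ 0 := Fintype.card_ne_zero
  refine smul_right_injective M hcard (smul_right_injective M hcard ?_)
  simp only [hsum, h]

end Updates

section Rotate

variable {R : Matrix (Fin 3) (Fin 3) ℝ} {p : ℕ}

theorem rotate_sub (R : Matrix (Fin 3) (Fin 3) ℝ) (T T' : Tensor p) :
    rotate R (fun a => T a - T' a) = fun a => rotate R T a - rotate R T' a := by
  funext a
  simp only [rotate, mul_sub, Finset.sum_sub_distrib]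

theorem rotate_rotate (R R' : Matrix (Fin 3) (Fin 3) ℝ) (T : Tensor p) :
    rotate R (rotate R' T) = rotate (R * R') T := by
  funext a
  simp only [rotate, Finset.mul_sum]
  rw [Finset.sum_comm]
  refine Finset.sum_congr rfl fun c _ => ?_
  simp only [← mul_assoc, ← Finset.sum_mul, ← Finset.prod_mul_distrib, Matrix.mul_apply,
    Fintype.prod_sum]

theorem rotate_one (T : Tensor p) : rotate 1 T = T := by
  funext a
  simp [rotate, Matrix.one_apply, Finset.prod_ite_zero, ← funext_iff]

theorem sum_rotate_mul (R : Matrix (Fin 3) (Fin 3) ℝ) (T U : Tensor p) :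
    ∑ a, rotate R T a * U a = ∑ a, T a * rotate Rᵀ U a := by
  simp only [rotate, Finset.sum_mul, Finset.mul_sum, Matrix.transpose_apply]
  rw [Finset.sum_comm]
  exact Finset.sum_congr rfl fun a _ => Finset.sum_congr rfl fun b _ => by ring

theorem sum_rotate_update_update (hR : Rᵀ * R = 1) {T : Tensor p} {i j : Fin p} (hij : i ≠ j)
    (hT : ∀ a, ∑ k, T (Function.update (Function.update a i k) j k) = 0) (a : Fin p → Fin 3) :
    ∑ k, rotate R T (Function.update (Function.update a i k) j k) = 0 := by
  have hδ (b c : Fin 3) : ∑ k, R k b * R k c = (1 : Matrix (Fin 3) (Fin 3) ℝ) b c := by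
    rw [← hR]
    rfl
  calc ∑ k, rotate R T (Function.update (Function.update a i k) j k)
      = ∑ b : Fin p → Fin 3, (1 : Matrix (Fin 3) (Fin 3) ℝ) (b i) (b j)
          * (∏ m ∈ (Finset.univ.erase i).erase j, R (a m) (b m)) * T b := by
        simp only [rotate, prod_eq_mul_mul_prod_erase_erase hij]
        rw [Finset.sum_comm]
        refine Finset.sum_congr rfl fun b _ => ?_
        simp only [prod_erase_erase_update_update i j a _ _ fun m x => R x (b m),
          Function.update_self, Function.update_of_ne hij, ← Finset.sum_mul, hδ]
    _ = ∑ b : Fin p → Fin 3, 0 * (∏ m ∈ (Finset.univ.erase i).erase j, R (a m) (b m)) * T b :=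
        sum_mul_prod_erase_erase_congr hij (c' := fun _ _ => 0) (fun m => R (a m)) fun b => by
          simp [Matrix.one_apply, hT b]
    _ = 0 := by simp

theorem rotate_mem_stf (hR : Rᵀ * R = 1) {T : Tensor p} (hT : WithLp.toLp 2 T ∈ stf p) :
    WithLp.toLp 2 (rotate R T) ∈ stf p := by
  refine ⟨fun σ a => ?_, fun i j hij => sum_rotate_update_update hR hij (hT.2 i j hij)⟩
  change rotate R T (a ∘ σ) = rotate R T a
  refine Fintype.sum_equiv (Equiv.arrowCongr σ (Equiv.refl _)) _ _ fun b => ?_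
  change _ = _ * T (b ∘ σ.symm)
  rw [show T (b ∘ σ.symm) = T b from hT.1 σ.symm b]
  congr 1
  exact Fintype.prod_equiv σ _ _ fun k => by simp

end Rotate

section StfPart

variable {p : ℕ}

theorem stfPart_of_mem {T : Tensor p} (hT : WithLp.toLp 2 T ∈ stf p) : stfPart T = T := by
  funext a
  rw [stfPart, Submodule.starProjection_eq_self_iff.2 hT]

theorem stfPart_sub (T T' : Tensor p) :
    stfPart (fun a => T a - T' a) = fun a => stfPart T a - stfPart T' a := by
  funext a
  have : WithLp.toLp 2 (fun a => T a - T' a) = WithLp.toLp 2 T - WithLp.toLp 2 T' := rfl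
  rw [stfPart, this, map_sub]
  rfl

theorem inner_eq_sum_mul (X Y : EuclideanSpace ℝ (Fin p → Fin 3)) :
    inner ℝ X Y = ∑ a, X a * Y a := by
  simp [PiLp.inner_apply, mul_comm]

theorem stfPart_rotate {R : Matrix (Fin 3) (Fin 3) ℝ} (hR : Rᵀ * R = 1) (T : Tensor p) :
    stfPart (rotate R T) = rotate R (stfPart T) := by
  have hmem : WithLp.toLp 2 (stfPart T) ∈ stf p := (stf p).starProjection_apply_mem _
  have key : (stf p).starProjection (WithLp.toLp 2 (rotate R T))
      = WithLp.toLp 2 (rotate R (stfPart T)) := by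
    refine Submodule.eq_starProjection_of_mem_of_inner_eq_zero (rotate_mem_stf hR hmem)
      fun w hw => ?_
    have hw' : WithLp.toLp 2 (rotate Rᵀ w.ofLp) ∈ stf p :=
      rotate_mem_stf (by rw [Matrix.transpose_transpose, mul_eq_one_comm.1 hR]) hw
    have h0 := Submodule.starProjection_inner_eq_zero (K := stf p) (WithLp.toLp 2 T) _ hw'
    rw [inner_eq_sum_mul] at h0 ⊢
    have hadj := sum_rotate_mul R (fun a => T a - stfPart T a) w.ofLp
    rw [rotate_sub] at hadj
    exact hadj.trans h0
  funext a
  rw [stfPart, key]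

theorem eq_of_stfPart_eq {T T' : Tensor p}
    (hmem : WithLp.toLp 2 (fun a => T a - T' a) ∈ stf p) (h : stfPart T = stfPart T') :
    T = T' := by
  funext a
  have hsub := congrFun (stfPart_of_mem hmem) a
  rw [stfPart_sub, h] at hsub
  exact sub_eq_zero.1 (hsub.symm.trans (sub_self _))

end StfPart

/-! ### Spinors of symmetric trace-free tensors -/

theorem waerden_symm (a : Fin 3) (A B : Fin 2) : waerden a A B = waerden a B A := by
  fin_cases a <;> fin_cases A <;> fin_cases B <;> simp [waerden]

theorem inv_sqrt_two_mul_self :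
    ((Real.sqrt 2 : ℝ) : ℂ)⁻¹ * ((Real.sqrt 2 : ℝ) : ℂ)⁻¹ = 1 / 2 := by
  rw [← mul_inv, ← Complex.ofReal_mul, Real.mul_self_sqrt (by norm_num)]
  norm_num

theorem waerden_orthonormal (a c : Fin 3) :
    ∑ A, ∑ B, starRingEnd ℂ (waerden c A B) * waerden a A B = if a = c then 1 else 0 := by
  have h := inv_sqrt_two_mul_self
  fin_cases a <;> fin_cases c <;> simp [waerden, Fin.sum_univ_two] <;> grind [Complex.I_mul_I]

theorem waerden_reality (a : Fin 3) (A B : Fin 2) :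
    ∑ A', ∑ B', tau A A' * tau B B' * starRingEnd ℂ (waerden a A' B') = -waerden a A B := by
  fin_cases a <;> fin_cases A <;> fin_cases B <;>
    simp [waerden, tau, eps, Fin.sum_univ_two]

theorem waerden_exchange (t : Fin 3 → Fin 3 → ℂ) (hs : ∀ u v, t u v = t v u)
    (ht : ∑ u, t u u = 0) (A B C D : Fin 2) :
    ∑ u, ∑ v, waerden u A B * waerden v C D * t u v
      = ∑ u, ∑ v, waerden u C B * waerden v A D * t u v := by
  have h2 : t 2 2 = -t 0 0 - t 1 1 := by
    rw [Fin.sum_univ_three] at ht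
    linear_combination ht
  fin_cases A <;> fin_cases B <;> fin_cases C <;> fin_cases D <;>
    simp [waerden, Fin.sum_univ_three, h2, hs 1 0, hs 2 0, hs 2 1] <;> grind [Complex.I_mul_I]

theorem sum_prod_pairs {ι K M : Type*} [Fintype ι] [DecidableEq ι] [Fintype K] [CommSemiring M]
    (G : ι → K → K → M) :
    ∑ s : ι × Fin 2 → K, ∏ k, G k (s (k, 0)) (s (k, 1)) = ∏ k, ∑ A, ∑ B, G k A B := by
  have hpair (k : ι) : ∑ A, ∑ B, G k A B = ∑ x : Fin 2 → K, G k (x 0) (x 1) := by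
    rw [← Fintype.sum_prod_type']
    exact (Fintype.sum_equiv (finTwoArrowEquiv K) _ _ fun x => rfl).symm
  simp only [hpair, Fintype.prod_sum]
  exact Fintype.sum_equiv (Equiv.curry _ _ _) _ _ fun s => rfl

section Spinor

variable {p : ℕ}

theorem toSpinor_sub (T T' : Tensor p) :
    toSpinor (fun a => T a - T' a) = fun s => toSpinor T s - toSpinor T' s := by
  funext s
  simp only [toSpinor, Complex.ofReal_sub, mul_sub, Finset.sum_sub_distrib]

theorem sum_conj_waerden_mul_toSpinor (T : Tensor p) (c : Fin p → Fin 3) :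
    ∑ s : Fin p × Fin 2 → Fin 2,
      (∏ k, starRingEnd ℂ (waerden (c k) (s (k, 0)) (s (k, 1)))) * toSpinor T s = T c := by
  have horth (a : Fin p → Fin 3) : ∑ s : Fin p × Fin 2 → Fin 2,
      ∏ k, starRingEnd ℂ (waerden (c k) (s (k, 0)) (s (k, 1)))
        * waerden (a k) (s (k, 0)) (s (k, 1)) = if a = c then 1 else 0 := by
    rw [sum_prod_pairs fun k A B => starRingEnd ℂ (waerden (c k) A B) * waerden (a k) A B]
    simp only [waerden_orthonormal]
    simp [Finset.prod_ite_zero, funext_iff, eq_comm]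
  simp only [toSpinor, Finset.mul_sum]
  rw [Finset.sum_comm]
  simp only [← mul_assoc, ← Finset.sum_mul, ← Finset.prod_mul_distrib, horth, ite_mul, one_mul,
    zero_mul, Finset.sum_ite_eq', Finset.mem_univ, if_true]

theorem toSpinor_injective : Function.Injective (toSpinor (p := p)) := fun T T' h => by
  funext c
  have hc := sum_conj_waerden_mul_toSpinor T c
  rw [h, sum_conj_waerden_mul_toSpinor] at hc
  exact_mod_cast hc.symm

theorem realityCondition_toSpinor (T : Tensor p) : RealityCondition (toSpinor T) := by
  intro s
  have hterm (s' : Fin p × Fin 2 → Fin 2) :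
      (∏ k, tau (s k) (s' k)) * starRingEnd ℂ (toSpinor T s')
      = ∑ a : Fin p → Fin 3, (∏ k, tau (s (k, 0)) (s' (k, 0)) * tau (s (k, 1)) (s' (k, 1))
        * starRingEnd ℂ (waerden (a k) (s' (k, 0)) (s' (k, 1)))) * (T a : ℂ) := by
    simp only [toSpinor, map_sum, map_mul, map_prod, Complex.conj_ofReal, Finset.mul_sum,
      ← mul_assoc, Fintype.prod_prod_type, Fin.prod_univ_two, Finset.prod_mul_distrib]
  have hfactor (a : Fin p → Fin 3) : ∑ s' : Fin p × Fin 2 → Fin 2,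
      ∏ k, tau (s (k, 0)) (s' (k, 0)) * tau (s (k, 1)) (s' (k, 1))
        * starRingEnd ℂ (waerden (a k) (s' (k, 0)) (s' (k, 1)))
      = (-1) ^ p * ∏ k, waerden (a k) (s (k, 0)) (s (k, 1)) := by
    rw [sum_prod_pairs fun k A B => tau (s (k, 0)) A * tau (s (k, 1)) B
      * starRingEnd ℂ (waerden (a k) A B)]
    simp only [waerden_reality, Finset.prod_neg, Finset.card_univ, Fintype.card_fin]
  simp only [hterm]
  rw [Finset.sum_comm]
  simp only [← Finset.sum_mul, hfactor]
  simp only [mul_assoc, ← Finset.mul_sum]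
  rw [← mul_assoc, ← mul_pow, neg_one_mul, neg_neg, one_pow, one_mul, toSpinor]

theorem toSpinor_comp_swap_pair (T : Tensor p) (j : Fin p) (s : Fin p × Fin 2 → Fin 2) :
    toSpinor T (s ∘ Equiv.swap (j, 0) (j, 1)) = toSpinor T s := by
  refine Finset.sum_congr rfl fun a _ => ?_
  congr 1
  refine Finset.prod_congr rfl fun m _ => ?_
  rcases eq_or_ne m j with rfl | hm
  · simp [waerden_symm (a m) (s (m, 1))]
  · simp [Equiv.swap_apply_of_ne_of_ne, hm]

theorem toSpinor_comp_swap_pairs {T : Tensor p} (hT : WithLp.toLp 2 T ∈ stf p)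
    {j k : Fin p} (hjk : j ≠ k) (s : Fin p × Fin 2 → Fin 2) :
    toSpinor T (s ∘ Equiv.swap (j, 0) (k, 0)) = toSpinor T s := by
  have hrest (a : Fin p → Fin 3) : ∏ m ∈ (Finset.univ.erase j).erase k,
      waerden (a m) ((s ∘ Equiv.swap (j, 0) (k, 0)) (m, 0))
        ((s ∘ Equiv.swap (j, 0) (k, 0)) (m, 1))
      = ∏ m ∈ (Finset.univ.erase j).erase k, waerden (a m) (s (m, 0)) (s (m, 1)) := by
    refine Finset.prod_congr rfl fun m hm => ?_
    simp only [Finset.mem_erase] at hm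
    simp [Equiv.swap_apply_of_ne_of_ne, hm.1, hm.2.1]
  simp only [toSpinor, prod_eq_mul_mul_prod_erase_erase hjk, hrest]
  simp only [Function.comp_apply, Equiv.swap_apply_left, Equiv.swap_apply_right,
    Equiv.swap_apply_of_ne_of_ne (a := ((j, 0) : Fin p × Fin 2)) (b := (k, 0)) (x := (_, 1))
      (by simp) (by simp)]
  refine sum_mul_prod_erase_erase_congr hjk
    (c := fun u v => waerden u (s (k, 0)) (s (j, 1)) * waerden v (s (j, 0)) (s (k, 1)))
    (c' := fun u v => waerden u (s (j, 0)) (s (j, 1)) * waerden v (s (k, 0)) (s (k, 1)))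
    (fun m x => waerden x (s (m, 0)) (s (m, 1))) fun a => ?_
  refine waerden_exchange (fun u v => (T (Function.update (Function.update a j u) k v) : ℂ))
    (fun u v => ?_) ?_ _ _ _ _
  · rw [← update_update_comp_swap hjk]
    exact congrArg _ (hT.1 (Equiv.swap j k) _)
  · exact_mod_cast hT.2 j k hjk a

theorem totallySymmetric_of_swap {T : Spinor p}
    (hpair : ∀ j s, T (s ∘ Equiv.swap (j, 0) (j, 1)) = T s)
    (hpairs : ∀ j k, j ≠ k → ∀ s, T (s ∘ Equiv.swap (j, 0) (k, 0)) = T s) :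
    TotallySymmetric T := by
  let H : Submonoid (Equiv.Perm (Fin p × Fin 2)) :=
    { carrier := {σ | ∀ s, T (s ∘ σ) = T s}
      mul_mem' := fun {σ ρ} hσ hρ s => by
        rw [Equiv.Perm.coe_mul, ← Function.comp_assoc, hρ, hσ]
      one_mem' := fun s => rfl }
  have hfst (x : Fin p × Fin 2) : Equiv.swap (x.1, 0) x ∈ H := by
    obtain ⟨j, b⟩ := x
    fin_cases b
    · exact Equiv.swap_self ((j, 0) : Fin p × Fin 2) ▸ H.one_mem
    · exact hpair j
  have hzero (j k : Fin p) : Equiv.swap (j, 0) (k, 0) ∈ H := by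
    rcases eq_or_ne j k with rfl | hjk
    · exact Equiv.swap_self ((j, 0) : Fin p × Fin 2) ▸ H.one_mem
    · exact hpairs j k hjk
  have htop : H = ⊤ := by
    rw [eq_top_iff, ← Equiv.Perm.mclosure_isSwap, Submonoid.closure_le]
    rintro σ ⟨x, y, -, rfl⟩
    exact SubmonoidClass.swap_mem_trans H (Equiv.swap_comm x _ ▸ hfst x)
      (SubmonoidClass.swap_mem_trans H (hzero x.1 y.1) (hfst y))
  exact fun σ => (htop ▸ Submonoid.mem_top σ : σ ∈ H)

theorem toSpinor_totallySymmetric {T : Tensor p} (hT : WithLp.toLp 2 T ∈ stf p) :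
    TotallySymmetric (toSpinor T) :=
  totallySymmetric_of_swap (toSpinor_comp_swap_pair T) fun _ _ => toSpinor_comp_swap_pairs hT

theorem symPart_of_totallySymmetric {T : Spinor p} (hT : TotallySymmetric T) :
    symPart T = T := by
  funext s
  have hcard : Fintype.card (Equiv.Perm (Fin p × Fin 2)) = (2 * p).factorial := by
    rw [Fintype.card_perm, Fintype.card_prod, Fintype.card_fin, Fintype.card_fin, mul_comm]
  have hne : ((2 * p).factorial : ℂ) ≠ 0 := by exact_mod_cast Nat.factorial_ne_zero _
  simp only [symPart, fun σ => hT σ s, Finset.sum_const, Finset.card_univ, hcard, nsmul_eq_mul]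
  field_simp

theorem symPart_sub (T T' : Spinor p) :
    symPart (fun s => T s - T' s) = fun s => symPart T s - symPart T' s := by
  funext s
  simp only [symPart, Finset.sum_sub_distrib, mul_sub]

theorem eq_of_symPart_toSpinor_eq {T T' : Tensor p}
    (hmem : WithLp.toLp 2 (fun a => T a - T' a) ∈ stf p)
    (h : symPart (toSpinor T) = symPart (toSpinor T')) : T = T' := by
  refine toSpinor_injective (funext fun t => ?_)
  have hsub := congrFun (symPart_of_totallySymmetric (toSpinor_totallySymmetric hmem)) t
  rw [toSpinor_sub, symPart_sub, h] at hsub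
  exact sub_eq_zero.1 (hsub.symm.trans (sub_self _))

end Spinor

/-! ### Covariance under rotations -/

section Rotation

variable (R : Matrix.orthogonalGroup (Fin 3) ℝ)

theorem transpose_mul_self_of_orthogonal : (R : Matrix (Fin 3) (Fin 3) ℝ)ᵀ * R = 1 :=
  (Matrix.mem_orthogonalGroup_iff' _ _).1 R.2

theorem mul_transpose_self_of_orthogonal : (R : Matrix (Fin 3) (Fin 3) ℝ) * Rᵀ = 1 :=
  (Matrix.mem_orthogonalGroup_iff _ _).1 R.2

/-- The linear map `y ↦ R y` of the coordinate space. -/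
def rotation : E3 ≃L[ℝ] E3 :=
  .ofUnit (Units.map (Matrix.toEuclideanCLM (n := Fin 3) (𝕜 := ℝ)).toMonoidHom
    (Unitary.toUnits R))

theorem rotation_apply (y : E3) (i : Fin 3) : rotation R y i = ∑ j, R.1 i j * y j := rfl

theorem tendsto_rotation : Tendsto (rotation R) (𝓝 0) (𝓝 0) := by
  simpa using (rotation R).continuous.tendsto 0

theorem rotation_single (i : Fin 3) :
    rotation R (EuclideanSpace.single i 1) = ∑ b, R.1 b i • (EuclideanSpace.single b 1 : E3) := by
  ext b
  simp [rotation_apply, Finset.sum_apply, Pi.single_apply]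

theorem pd_comp_rotation (f : E3 → ℝ) (i : Fin 3) (y : E3) :
    pd i (fun z => f (rotation R z)) y = ∑ b, R.1 b i * pd b f (rotation R y) := by
  change fderiv ℝ (f ∘ rotation R) y _ = _
  rw [(rotation R).comp_right_fderiv]
  simp [pd, rotation_single]

theorem contDiffAt_comp_rotation {r : WithTop ℕ∞} {f : E3 → ℝ} (hf : ContDiffAt ℝ r f 0) :
    ContDiffAt ℝ r (fun y => f (rotation R y)) 0 :=
  ContDiffAt.comp (0 : E3) (by simpa using hf) (rotation R).contDiff.contDiffAt

/-- The conjugation `X ↦ Rᵀ X R`, which is how the rotation `y ↦ R y` of the coordinates acts on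
the components of bilinear forms, of endomorphisms and of frames. -/
def conjBy : Matrix (Fin 3) (Fin 3) ℝ ≃⋆ₐ[ℝ] Matrix (Fin 3) (Fin 3) ℝ :=
  (Unitary.conjStarAlgAut ℝ (Matrix (Fin 3) (Fin 3) ℝ) R).symm

theorem conjBy_eq (X : Matrix (Fin 3) (Fin 3) ℝ) :
    conjBy R X = (R : Matrix (Fin 3) (Fin 3) ℝ)ᵀ * X * R := by
  rw [conjBy, Unitary.conjStarAlgAut_symm_apply, Matrix.star_eq_conjTranspose,
    Matrix.conjTranspose_eq_transpose_of_trivial]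

theorem conjBy_apply (X : Matrix (Fin 3) (Fin 3) ℝ) (i j : Fin 3) :
    conjBy R X i j = ∑ a, ∑ b, R.1 a i * R.1 b j * X a b := by
  simp only [conjBy_eq, Matrix.mul_apply, Matrix.transpose_apply, Finset.sum_mul]
  rw [Finset.sum_comm]
  exact Finset.sum_congr rfl fun a _ => Finset.sum_congr rfl fun b _ => by ring

theorem sum_rotation_mul_rotation (X : Matrix (Fin 3) (Fin 3) ℝ) (u w : E3) :
    ∑ i, ∑ j, rotation R u i * rotation R w j * X i j
      = ∑ i, ∑ j, u i * w j * conjBy R X i j := by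
  simp only [conjBy_apply, rotation_apply, Fin.sum_univ_three]
  ring

theorem conjBy_transpose (X : Matrix (Fin 3) (Fin 3) ℝ) : conjBy R Xᵀ = (conjBy R X)ᵀ := by
  simp only [conjBy_eq, Matrix.transpose_mul, Matrix.transpose_transpose, mul_assoc]

theorem conjBy_inv (X : Matrix (Fin 3) (Fin 3) ℝ) : conjBy R X⁻¹ = (conjBy R X)⁻¹ := by
  simp only [conjBy_eq, Matrix.mul_inv_rev,
    Matrix.inv_eq_left_inv (transpose_mul_self_of_orthogonal R),
    Matrix.inv_eq_left_inv (mul_transpose_self_of_orthogonal R), mul_assoc]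

theorem trace_conjBy (X : Matrix (Fin 3) (Fin 3) ℝ) : (conjBy R X).trace = X.trace := by
  rw [conjBy_eq, Matrix.trace_mul_comm, ← mul_assoc, mul_transpose_self_of_orthogonal, one_mul]

theorem sum_mul_conjBy (X : Matrix (Fin 3) (Fin 3) ℝ) (d i : Fin 3) :
    ∑ l, R.1 d l * conjBy R X l i = (X * R.1) d i := by
  rw [← Matrix.mul_apply, conjBy_eq, ← mul_assoc, ← mul_assoc, mul_transpose_self_of_orthogonal,
    one_mul]

end Rotation

section MatrixFields

variable {g : E3 → Matrix (Fin 3) (Fin 3) ℝ}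

/-- The partial derivative of a matrix valued function, taken entrywise. -/
def pdM (i : Fin 3) (M : E3 → Matrix (Fin 3) (Fin 3) ℝ) (y : E3) : Matrix (Fin 3) (Fin 3) ℝ :=
  Matrix.of fun a b => pd i (fun z => M z a b) y

/-- The connection matrix `(Γ^i_{jk})_{ik}` of the `j`-th coordinate direction. -/
def christoffelM (g : E3 → Matrix (Fin 3) (Fin 3) ℝ) (j : Fin 3) (y : E3) :
    Matrix (Fin 3) (Fin 3) ℝ := Matrix.of fun i k => christoffel g i j k y

/-- The curvature `∂_l Γ_j - ∂_j Γ_l + [Γ_l, Γ_j]` in terms of the connection matrices. -/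
def curvatureM (g : E3 → Matrix (Fin 3) (Fin 3) ℝ) (l j : Fin 3) (y : E3) :
    Matrix (Fin 3) (Fin 3) ℝ :=
  pdM l (christoffelM g j) y - pdM j (christoffelM g l) y
    + (christoffelM g l y * christoffelM g j y - christoffelM g j y * christoffelM g l y)

theorem pdM_congr {M M' : E3 → Matrix (Fin 3) (Fin 3) ℝ} (h : M =ᶠ[𝓝 0] M') (i : Fin 3) :
    pdM i M =ᶠ[𝓝 0] pdM i M' := by
  have hentry : ∀ᶠ y in 𝓝 (0 : E3), ∀ a b, pd i (fun z => M z a b) y = pd i (fun z => M' z a b) y :=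
    Filter.eventually_all.2 fun a => Filter.eventually_all.2 fun b =>
      pd_congr (h.mono fun y hy => by rw [hy]) i
  filter_upwards [hentry] with y hy
  ext a b
  exact hy a b

theorem pd_sum_const_mul {ι : Type*} [Fintype ι] (c : ι → ℝ) {f : ι → E3 → ℝ}
    (hf : ∀ b, ContDiffAt ℝ ∞ (f b) 0) (i : Fin 3) :
    pd i (fun y => ∑ b, c b * f b y) =ᶠ[𝓝 0] fun y => ∑ b, c b * pd i (f b) y := by
  filter_upwards [pd_sum (s := Finset.univ) (fun b _ => contDiffAt_const.mul (hf b)) i,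
    Filter.eventually_all.2 fun b => pd_const_mul (c b) (hf b) i] with y hsum hmul
  exact hsum.trans (Finset.sum_congr rfl fun b _ => hmul b)

theorem pdM_sum_smul {M : Fin 3 → E3 → Matrix (Fin 3) (Fin 3) ℝ}
    (hM : ∀ b i j, ContDiffAt ℝ ∞ (fun y => M b y i j) 0) (c : Fin 3 → ℝ) (i : Fin 3) :
    pdM i (fun y => ∑ b, c b • M b y) =ᶠ[𝓝 0] fun y => ∑ b, c b • pdM i (M b) y := by
  have hentry : ∀ᶠ y in 𝓝 (0 : E3), ∀ a d, pd i (fun z => ∑ b, c b * M b z a d) y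
      = ∑ b, c b * pd i (fun z => M b z a d) y :=
    Filter.eventually_all.2 fun a => Filter.eventually_all.2 fun d =>
      pd_sum_const_mul c (fun b => hM b a d) i
  filter_upwards [hentry] with y hy
  ext a d
  simpa only [pdM, Matrix.of_apply, Matrix.sum_apply, Matrix.smul_apply, smul_eq_mul] using hy a d

theorem christoffel_symm (hs : ∀ y i j, g y i j = g y j i) (i j k : Fin 3) :
    christoffel g i j k = christoffel g i k j := by
  funext y
  simp only [christoffel, hs _ k j]
  congr 1
  exact Finset.sum_congr rfl fun l _ => by ring

theorem christoffelM_eq (hs : ∀ y i j, g y i j = g y j i) (j : Fin 3) (y : E3) :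
    christoffelM g j y = (1 / 2 : ℝ) • ((g y)⁻¹ * (pdM j g y
      + (Matrix.of fun l k => pdM k g y l j) - (Matrix.of fun l k => pdM l g y k j))) := by
  ext i k
  simp only [christoffelM, christoffel, Matrix.of_apply, Matrix.smul_apply, smul_eq_mul,
    Matrix.mul_apply, Matrix.sub_apply, Matrix.add_apply, pdM, hs _ k j]

theorem ricci_eq_sum_curvatureM (hs : ∀ y i j, g y i j = g y j i) (i j : Fin 3) (y : E3) :
    ricci g i j y = ∑ l, curvatureM g l j y l i := by
  refine Finset.sum_congr rfl fun l _ => ?_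
  simp only [curvatureM, Matrix.add_apply, Matrix.sub_apply, Matrix.mul_apply, pdM, christoffelM,
    Matrix.of_apply, ← Finset.sum_sub_distrib, christoffel_symm hs _ i]

end MatrixFields

section PullBack

variable (R : Matrix.orthogonalGroup (Fin 3) ℝ) {g : E3 → Matrix (Fin 3) (Fin 3) ℝ}
  {M : E3 → Matrix (Fin 3) (Fin 3) ℝ}

/-- The pull-back of a matrix valued function by the rotation `y ↦ R y` of the coordinates. -/
def pullM (M : E3 → Matrix (Fin 3) (Fin 3) ℝ) (y : E3) : Matrix (Fin 3) (Fin 3) ℝ :=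
  conjBy R (M (rotation R y))

theorem contDiffAt_pullM {r : WithTop ℕ∞} (hM : ∀ i j, ContDiffAt ℝ r (fun y => M y i j) 0)
    (i j : Fin 3) : ContDiffAt ℝ r (fun y => pullM R M y i j) 0 := by
  simp only [pullM, conjBy_apply]
  exact ContDiffAt.sum fun a _ => ContDiffAt.sum fun b _ => contDiffAt_const.mul
    (contDiffAt_comp_rotation R (hM a b))

theorem pullM_symm (hs : ∀ y i j, g y i j = g y j i) (y : E3) (i j : Fin 3) :
    pullM R g y i j = pullM R g y j i := by
  have hsymm : (g (rotation R y))ᵀ = g (rotation R y) := Matrix.ext fun a b => hs _ b a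
  have hpull : (pullM R g y)ᵀ = pullM R g y := by rw [pullM, ← conjBy_transpose, hsymm]
  exact congrFun (congrFun hpull j) i

theorem pdM_pullM (hM : ∀ i j, ContDiffAt ℝ ∞ (fun y => M y i j) 0) (i : Fin 3) :
    pdM i (pullM R M) =ᶠ[𝓝 0] fun y => ∑ b, R.1 b i • conjBy R (pdM b M (rotation R y)) := by
  have hentry : ∀ᶠ y in 𝓝 (0 : E3), ∀ a d,
      pd i (fun z => ∑ x : Fin 3 × Fin 3, R.1 x.1 a * R.1 x.2 d * M (rotation R z) x.1 x.2) y
      = ∑ x : Fin 3 × Fin 3, R.1 x.1 a * R.1 x.2 d * pd i (fun z => M (rotation R z) x.1 x.2) y :=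
    Filter.eventually_all.2 fun a => Filter.eventually_all.2 fun d =>
      pd_sum_const_mul (fun x : Fin 3 × Fin 3 => R.1 x.1 a * R.1 x.2 d)
        (fun x => contDiffAt_comp_rotation R (hM x.1 x.2)) i
  filter_upwards [hentry] with y hy
  ext a d
  have had := hy a d
  simp only [Fintype.sum_prod_type, fun x x' => pd_comp_rotation R (fun z => M z x x')] at had
  simp only [pdM, Matrix.of_apply, Matrix.sum_apply, Matrix.smul_apply, smul_eq_mul, pullM,
    conjBy_apply, had]
  simp only [Fin.sum_univ_three]
  ring

theorem christoffelM_pullM (hg : SmoothMetric g) (hs : ∀ y i j, g y i j = g y j i) :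
    ∀ᶠ y in 𝓝 (0 : E3), ∀ j, christoffelM (pullM R g) j y
      = ∑ b, R.1 b j • pullM R (christoffelM g b) y := by
  filter_upwards [Filter.eventually_all.2 fun i => pdM_pullM R hg.smooth i] with y hp j
  have hlast : (Matrix.of fun l k => pdM k (pullM R g) y l j)
      = ∑ b, R.1 b j • conjBy R (Matrix.of fun l k => pdM k g (rotation R y) l b) := by
    ext l k
    simp only [hp, Matrix.of_apply, Matrix.sum_apply, Matrix.smul_apply, smul_eq_mul,
      conjBy_apply, Fin.sum_univ_three]
    ring
  have hfirst : (Matrix.of fun l k => pdM l (pullM R g) y k j)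
      = ∑ b, R.1 b j • conjBy R (Matrix.of fun l k => pdM l g (rotation R y) k b) := by
    ext l k
    simp only [hp, Matrix.of_apply, Matrix.sum_apply, Matrix.smul_apply, smul_eq_mul,
      conjBy_apply, Fin.sum_univ_three]
    ring
  rw [christoffelM_eq (pullM_symm R hs), hlast, hfirst, hp, ← Finset.sum_add_distrib,
    ← Finset.sum_sub_distrib, Finset.mul_sum, Finset.smul_sum]
  refine Finset.sum_congr rfl fun b _ => ?_
  rw [← smul_add, ← smul_sub, ← map_add, ← map_sub, pullM, pullM, christoffelM_eq hs,
    ← conjBy_inv, mul_smul_comm, ← map_mul, map_smul, smul_comm]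

theorem curvatureM_pullM (hg : SmoothMetric g) (hs : ∀ y i j, g y i j = g y j i) :
    ∀ᶠ y in 𝓝 (0 : E3), ∀ l j, curvatureM (pullM R g) l j y
      = ∑ d, ∑ b, (R.1 d l * R.1 b j) • conjBy R (curvatureM g d b (rotation R y)) := by
  have hΓ := christoffelM_pullM R hg hs
  have hsm (b i j : Fin 3) : ContDiffAt ℝ ∞ (fun y => christoffelM g b y i j) 0 :=
    hg.smooth_christoffel i b j
  have hd : ∀ᶠ y in 𝓝 (0 : E3), ∀ l j, pdM l (christoffelM (pullM R g) j) y
      = ∑ b, R.1 b j • ∑ d, R.1 d l • conjBy R (pdM d (christoffelM g b) (rotation R y)) := by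
    refine Filter.eventually_all.2 fun l => Filter.eventually_all.2 fun j => ?_
    filter_upwards [pdM_congr (hΓ.mono fun y hy => hy j) l,
      pdM_sum_smul (fun b => contDiffAt_pullM R (hsm b)) (fun b => R.1 b j) l,
      Filter.eventually_all.2 fun b => pdM_pullM R (hsm b) l] with y h1 h2 h3
    simp only [h1, h2, h3]
  filter_upwards [hΓ, hd] with y hΓ hd l j
  simp only [curvatureM, hd, hΓ, pullM, map_add, map_sub, map_mul, smul_add, smul_sub,
    Finset.sum_add_distrib, Finset.sum_sub_distrib, Finset.sum_mul, Finset.mul_sum,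
    smul_mul_assoc, mul_smul_comm, Finset.smul_sum, smul_smul]
  refine congrArg₂ (· + ·) (congrArg₂ (· - ·) ?_ rfl) (congrArg₂ (· - ·) ?_ ?_)
  · rw [Finset.sum_comm]
    simp only [mul_comm]
  · rw [Finset.sum_comm]
    simp only [mul_comm (R.1 _ j)]
  · rfl

theorem ricci_pullM (hg : SmoothMetric g) (hs : ∀ y i j, g y i j = g y j i) :
    ∀ᶠ y in 𝓝 (0 : E3), ∀ i j, ricci (pullM R g) i j y
      = conjBy R (Matrix.of fun a b => ricci g a b (rotation R y)) i j := by
  filter_upwards [curvatureM_pullM R hg hs] with y hy i j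
  calc ricci (pullM R g) i j y
    _ = ∑ l, ∑ d, ∑ b, R.1 d l * R.1 b j
          * conjBy R (curvatureM g d b (rotation R y)) l i := by
      simp only [ricci_eq_sum_curvatureM (pullM_symm R hs), hy, Matrix.sum_apply,
        Matrix.smul_apply, smul_eq_mul]
    _ = ∑ d, ∑ b, R.1 b j
          * ∑ l, R.1 d l * conjBy R (curvatureM g d b (rotation R y)) l i := by
      simp only [Finset.mul_sum]
      rw [Finset.sum_comm]
      refine Finset.sum_congr rfl fun d _ => ?_
      rw [Finset.sum_comm]
      exact Finset.sum_congr rfl fun b _ => Finset.sum_congr rfl fun l _ => by ring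
    _ = conjBy R (Matrix.of fun a b => ricci g a b (rotation R y)) i j := by
      simp only [sum_mul_conjBy]
      simp only [Matrix.mul_apply, conjBy_apply, Matrix.of_apply, ricci_eq_sum_curvatureM hs]
      simp only [Fin.sum_univ_three]
      ring

end PullBack

section DerivAction

variable {p : ℕ}

/-- The action of an endomorphism on covariant tensors as a derivation,
`(X T)_{a_1 ... a_p} = ∑_i X^l_{a_i} T_{a_1 ... l ... a_p}`. -/
def derivAction (X : Matrix (Fin 3) (Fin 3) ℝ) (T : Tensor p) : Tensor p := fun a =>
  ∑ i, ∑ l, X l (a i) * T (Function.update a i l)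

theorem covDeriv_eq_pd_sub_derivAction (g : E3 → Matrix (Fin 3) (Fin 3) ℝ) (T : E3 → Tensor p)
    (y : E3) (a : Fin (p + 1) → Fin 3) :
    covDeriv g T y a = pd (a 0) (fun z => T z (Fin.tail a)) y
      - derivAction (christoffelM g (a 0) y) (T y) (Fin.tail a) := rfl

theorem derivAction_sum_smul (r : Fin 3 → ℝ) (X : Fin 3 → Matrix (Fin 3) (Fin 3) ℝ)
    (T : Tensor p) (a : Fin p → Fin 3) :
    derivAction (∑ c, r c • X c) T a = ∑ c, r c * derivAction (X c) T a := by
  simp only [derivAction, Matrix.sum_apply, Matrix.smul_apply, smul_eq_mul, Finset.mul_sum]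
  rw [Finset.sum_comm (γ := Fin 3)]
  refine Finset.sum_congr rfl fun i _ => ?_
  rw [Finset.sum_comm]
  refine Finset.sum_congr rfl fun l _ => ?_
  simp only [Finset.sum_mul, mul_assoc]

theorem prod_erase_update {ι K M : Type*} [Fintype ι] [DecidableEq ι] [CommMonoid M] (i : ι)
    (a : ι → K) (l : K) (G : ι → K → M) :
    ∏ k ∈ Finset.univ.erase i, G k (Function.update a i l k)
      = ∏ k ∈ Finset.univ.erase i, G k (a k) :=
  Finset.prod_congr rfl fun k hk => by rw [Function.update_of_ne (Finset.ne_of_mem_erase hk)]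

theorem derivAction_conjBy_rotate (R : Matrix.orthogonalGroup (Fin 3) ℝ)
    (X : Matrix (Fin 3) (Fin 3) ℝ) (T : Tensor p) :
    derivAction (conjBy R X) (rotate R.1ᵀ T) = rotate R.1ᵀ (derivAction X T) := by
  funext a
  simp only [derivAction, rotate, Matrix.transpose_apply, Finset.mul_sum]
  conv_rhs => rw [Finset.sum_comm]
  refine Finset.sum_congr rfl fun i _ => ?_
  have hslot (b : Fin p → Fin 3) : ∑ l, conjBy R X l (a i) * R.1 (b i) l
      = ∑ n, X (b i) n * R.1 n (a i) := by
    simpa only [mul_comm (R.1 _ _), Matrix.mul_apply] using sum_mul_conjBy R X (b i) (a i)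
  calc ∑ l, ∑ b : Fin p → Fin 3, conjBy R X l (a i)
          * ((∏ k, R.1 (b k) (Function.update a i l k)) * T b)
    _ = ∑ b : Fin p → Fin 3, (∑ l, conjBy R X l (a i) * R.1 (b i) l)
          * ((∏ k ∈ Finset.univ.erase i, R.1 (b k) (a k)) * T b) := by
      rw [Finset.sum_comm]
      refine Finset.sum_congr rfl fun b _ => ?_
      rw [Finset.sum_mul]
      refine Finset.sum_congr rfl fun l _ => ?_
      rw [← Finset.mul_prod_erase _ _ (Finset.mem_univ i), Function.update_self,
        prod_erase_update i a l fun k x => R.1 (b k) x]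
      ring
    _ = ∑ b : Fin p → Fin 3, ∑ n, X (b i) n * R.1 n (a i)
          * ((∏ k ∈ Finset.univ.erase i, R.1 (b k) (a k)) * T b) := by
      simp only [hslot, Finset.sum_mul]
    _ = ∑ b : Fin p → Fin 3, ∑ n, (∏ k, R.1 (b k) (a k))
          * (X n (b i) * T (Function.update b i n)) := by
      rw [sum_update_swap i]
      refine Finset.sum_congr rfl fun b _ => Finset.sum_congr rfl fun n _ => ?_
      rw [← Finset.mul_prod_erase _ _ (Finset.mem_univ i), Function.update_self,
        prod_erase_update i b n fun k x => R.1 x (a k)]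
      ring

end DerivAction

section Covariance

variable (R : Matrix.orthogonalGroup (Fin 3) ℝ) {g : E3 → Matrix (Fin 3) (Fin 3) ℝ} {p : ℕ}

theorem rotate_succ (Q : Matrix (Fin 3) (Fin 3) ℝ) (T : Tensor (p + 1))
    (a : Fin (p + 1) → Fin 3) :
    rotate Q T a = ∑ c, Q (a 0) c * rotate Q (fun b => T (Fin.cons c b)) (Fin.tail a) := by
  simp only [rotate, Finset.mul_sum]
  rw [← Fintype.sum_prod_type']
  refine (Fintype.sum_equiv (Fin.consEquiv fun _ => Fin 3) _ _ fun x => ?_).symm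
  simp only [Fin.consEquiv_apply, Fin.prod_univ_succ, Fin.cons_zero, Fin.cons_succ, Fin.tail_def,
    mul_assoc]
  rfl

theorem pd_rotate_comp {T : E3 → Tensor p} (hT : ∀ b, ContDiffAt ℝ ∞ (fun y => T y b) 0) :
    ∀ᶠ y in 𝓝 (0 : E3), ∀ i a, pd i (fun z => rotate R.1ᵀ (T (rotation R z)) a) y
      = ∑ c, R.1 c i * rotate R.1ᵀ (fun b => pd c (fun z => T z b) (rotation R y)) a := by
  refine Filter.eventually_all.2 fun i => Filter.eventually_all.2 fun a => ?_
  filter_upwards [pd_sum_const_mul (fun b : Fin p → Fin 3 => ∏ k, R.1ᵀ (a k) (b k))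
    (fun b => contDiffAt_comp_rotation R (hT b)) i] with y hy
  refine hy.trans ?_
  simp only [fun b => pd_comp_rotation R fun z => T z b, rotate, Finset.mul_sum]
  rw [Finset.sum_comm]
  simp only [mul_left_comm]

theorem iterCovDeriv_pullM (hg : SmoothMetric g) (hs : ∀ y i j, g y i j = g y j i)
    {φ : E3 → ℝ} (hφ : ContDiffAt ℝ ∞ φ 0) (p : ℕ) : ∀ᶠ y in 𝓝 (0 : E3),
    iterCovDeriv (pullM R g) (fun z => φ (rotation R z)) p y
      = rotate R.1ᵀ (iterCovDeriv g φ p (rotation R y)) := by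
  induction p with
  | zero => exact Eventually.of_forall fun y => by funext a; simp [iterCovDeriv, rotate]
  | succ p ih =>
    have hpd : ∀ᶠ y in 𝓝 (0 : E3), ∀ i a,
        pd i (fun z => iterCovDeriv (pullM R g) (fun z => φ (rotation R z)) p z a) y
          = pd i (fun z => rotate R.1ᵀ (iterCovDeriv g φ p (rotation R z)) a) y :=
      Filter.eventually_all.2 fun i => Filter.eventually_all.2 fun a =>
        pd_congr (ih.mono fun y hy => congrFun hy a) i
    filter_upwards [ih, hpd, pd_rotate_comp R (hg.smooth_iterCovDeriv hφ p),
      christoffelM_pullM R hg hs] with y ih hpd hrot hΓ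
    funext a
    rw [iterCovDeriv, covDeriv_eq_pd_sub_derivAction, hpd, hrot, ih, hΓ, derivAction_sum_smul,
      rotate_succ, ← Finset.sum_sub_distrib]
    simp only [pullM, derivAction_conjBy_rotate, ← mul_sub, iterCovDeriv,
      covDeriv_eq_pd_sub_derivAction, Fin.cons_zero, Fin.tail_cons, rotate_sub,
      Matrix.transpose_apply]

theorem hessian_pullM (hg : SmoothMetric g) (hs : ∀ y i j, g y i j = g y j i) {φ : E3 → ℝ}
    (hφ : ContDiffAt ℝ ∞ φ 0) : ∀ᶠ y in 𝓝 (0 : E3), ∀ i j,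
    iterCovDeriv (pullM R g) (fun z => φ (rotation R z)) 2 y ![i, j]
      = conjBy R (Matrix.of fun a b => iterCovDeriv g φ 2 (rotation R y) ![a, b]) i j := by
  filter_upwards [iterCovDeriv_pullM R hg hs hφ 2] with y hy i j
  rw [hy, conjBy_apply, ← Fintype.sum_prod_type', rotate]
  refine Fintype.sum_equiv (finTwoArrowEquiv (Fin 3)) _ _ fun b => ?_
  have hb : ![b 0, b 1] = b := by
    funext k
    fin_cases k <;> rfl
  simp [Fin.prod_univ_two, hb]

theorem laplacian_eq_trace (g : E3 → Matrix (Fin 3) (Fin 3) ℝ) (φ : E3 → ℝ) (y : E3) :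
    laplacian g φ y
      = ((g y)⁻¹ * (Matrix.of fun i j => iterCovDeriv g φ 2 y ![i, j])ᵀ).trace := by
  simp [laplacian, Matrix.trace, Matrix.mul_apply]

theorem laplacian_pullM (hg : SmoothMetric g) (hs : ∀ y i j, g y i j = g y j i) {φ : E3 → ℝ}
    (hφ : ContDiffAt ℝ ∞ φ 0) : ∀ᶠ y in 𝓝 (0 : E3),
    laplacian (pullM R g) (fun z => φ (rotation R z)) y = laplacian g φ (rotation R y) := by
  filter_upwards [hessian_pullM R hg hs hφ] with y hy
  have hhess : (Matrix.of fun i j =>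
      iterCovDeriv (pullM R g) (fun z => φ (rotation R z)) 2 y ![i, j])
      = conjBy R (Matrix.of fun a b => iterCovDeriv g φ 2 (rotation R y) ![a, b]) :=
    Matrix.ext hy
  rw [laplacian_eq_trace, hhess, pullM, ← conjBy_inv, ← conjBy_transpose, ← map_mul,
    trace_conjBy, laplacian_eq_trace]

theorem sum_smul_sum_smul_conjBy (y : E3) (X : Fin 3 → Matrix (Fin 3) (Fin 3) ℝ) :
    ∑ j, y j • ∑ b, R.1 b j • conjBy R (X b) = conjBy R (∑ b, rotation R y b • X b) := by
  simp only [map_sum, map_smul, rotation_apply, Finset.sum_smul, Finset.smul_sum, smul_smul]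
  rw [Finset.sum_comm]
  simp only [mul_comm]

theorem conjBy_mulVec (X : Matrix (Fin 3) (Fin 3) ℝ) (y : E3) :
    conjBy R X *ᵥ y = R.1ᵀ *ᵥ (X *ᵥ (rotation R y)) := by
  rw [conjBy_eq, ← Matrix.mulVec_mulVec, ← Matrix.mulVec_mulVec]
  rfl

theorem sum_christoffel_mul_mul (g : E3 → Matrix (Fin 3) (Fin 3) ℝ) (y v : E3) (i : Fin 3) :
    ∑ j, ∑ k, christoffel g i j k y * v j * v k
      = ((∑ j, v j • christoffelM g j y) *ᵥ v) i := by
  simp only [Matrix.mulVec, dotProduct, Matrix.sum_apply, Matrix.smul_apply, smul_eq_mul,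
    christoffelM, Matrix.of_apply, Finset.sum_mul]
  rw [Finset.sum_comm]
  simp only [mul_comm (christoffel _ _ _ _ _)]

/-- A frame field, given by its components `e i a`, as a matrix valued function. -/
def frameM (e : Fin 3 → Fin 3 → E3 → ℝ) (y : E3) : Matrix (Fin 3) (Fin 3) ℝ :=
  Matrix.of fun i a => e i a y

theorem sum_parallel_eq (g : E3 → Matrix (Fin 3) (Fin 3) ℝ) (e : Fin 3 → Fin 3 → E3 → ℝ)
    (y v : E3) (i a : Fin 3) :
    ∑ j, v j * (pd j (e i a) y + ∑ k, christoffel g i j k y * e k a y)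
      = (∑ j, v j • pdM j (frameM e) y + (∑ j, v j • christoffelM g j y) * frameM e y) i a := by
  simp only [Matrix.add_apply, Finset.sum_mul, Matrix.sum_apply, Matrix.smul_apply, smul_eq_mul,
    smul_mul_assoc, Matrix.mul_apply, pdM, christoffelM, frameM, Matrix.of_apply, mul_add,
    Finset.sum_add_distrib]

/-- The components of a frame field with respect to the coordinates and to the frame obtained from
it by the rotation `y ↦ R y` of the coordinates. -/
def pullFrame (e : Fin 3 → Fin 3 → E3 → ℝ) (i a : Fin 3) (y : E3) : ℝ :=
  pullM R (frameM e) y i a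

theorem fieldArg_pullFrame {n : ℕ} (φ : Fin n → E3 → ℝ) (e : Fin 3 → Fin 3 → E3 → ℝ) (y : E3) :
    fieldArg (fun α y => φ α (rotation R y)) (pullFrame R e) y
      = ((fieldArg φ e (rotation R y)).1,
          fun γ => R.1ᵀ *ᵥ (fieldArg φ e (rotation R y)).2 γ) := by
  refine Prod.ext rfl (funext fun γ => funext fun a => ?_)
  calc ∑ i, pullFrame R e i a y * pd i (fun y => φ γ (rotation R y)) y
    _ = ∑ b, (∑ i, R.1 b i * conjBy R (frameM e (rotation R y)) i a)
          * pd b (φ γ) (rotation R y) := by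
      simp only [pd_comp_rotation, pullFrame, pullM, Finset.mul_sum, Finset.sum_mul]
      rw [Finset.sum_comm]
      exact Finset.sum_congr rfl fun b _ => Finset.sum_congr rfl fun i _ => by ring
    _ = ∑ c, R.1 c a * ∑ b, e b c (rotation R y) * pd b (φ γ) (rotation R y) := by
      simp only [sum_mul_conjBy, Matrix.mul_apply, frameM, Matrix.of_apply, Finset.mul_sum,
        Finset.sum_mul]
      rw [Finset.sum_comm]
      exact Finset.sum_congr rfl fun c _ => Finset.sum_congr rfl fun b _ => by ring

theorem conjBy_of_mul (u v : Fin 3 → ℝ) (i j : Fin 3) :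
    conjBy R (Matrix.of fun a b => u a * v b) i j
      = (∑ a, R.1 a i * u a) * ∑ b, R.1 b j * v b := by
  simp only [conjBy_apply, Matrix.of_apply, Finset.sum_mul_sum]
  exact Finset.sum_congr rfl fun a _ => Finset.sum_congr rfl fun b _ => by ring

namespace IsSolutionGerm

variable {n : ℕ} {S : FieldSystem n} {φ : Fin n → E3 → ℝ} {e : Fin 3 → Fin 3 → E3 → ℝ}

theorem normal_pullM (h : IsSolutionGerm S g φ e) : ∀ᶠ y in 𝓝 (0 : E3), ∀ i,
    ∑ j, ∑ k, christoffel (pullM R g) i j k y * y j * y k = 0 := by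
  filter_upwards [(tendsto_rotation R).eventually h.normal,
    christoffelM_pullM R h.smoothMetric h.symm] with y hn hΓ i
  have hzero : (∑ b, rotation R y b • christoffelM g b (rotation R y)) *ᵥ rotation R y = 0 :=
    funext fun m => (sum_christoffel_mul_mul g _ _ m).symm.trans (hn m)
  simp only [sum_christoffel_mul_mul, hΓ, pullM, sum_smul_sum_smul_conjBy, conjBy_mulVec, hzero,
    Matrix.mulVec_zero, Pi.zero_apply]

theorem parallel_pullM (h : IsSolutionGerm S g φ e) : ∀ᶠ y in 𝓝 (0 : E3), ∀ i a,
    ∑ j, y j * (pd j (pullFrame R e i a) y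
      + ∑ k, christoffel (pullM R g) i j k y * pullFrame R e k a y) = 0 := by
  filter_upwards [(tendsto_rotation R).eventually h.parallel,
    christoffelM_pullM R h.smoothMetric h.symm,
    Filter.eventually_all.2 fun j => pdM_pullM R (M := frameM e) h.smooth_e j]
    with y hp hΓ hpd i a
  have hzero : ∑ b, rotation R y b • pdM b (frameM e) (rotation R y)
      + (∑ b, rotation R y b • christoffelM g b (rotation R y)) * frameM e (rotation R y) = 0 :=
    Matrix.ext fun m a => (sum_parallel_eq g e _ _ m a).symm.trans (hp m a)
  have hframe : frameM (pullFrame R e) = pullM R (frameM e) := rfl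
  rw [sum_parallel_eq, hframe]
  simp only [hΓ, hpd, pullM, sum_smul_sum_smul_conjBy, ← map_mul, ← map_add, hzero, map_zero,
    Matrix.zero_apply]

theorem eq_ricci_pullM (h : IsSolutionGerm S g φ e)
    (hR : R.1ᵀ ∈ Matrix.specialOrthogonalGroup (Fin 3) ℝ) : ∀ᶠ y in 𝓝 (0 : E3), ∀ i j,
      ricci (pullM R g) i j y = ∑ α, S.F1 α (fun γ => φ γ (rotation R y))
          * iterCovDeriv (pullM R g) (fun y => φ α (rotation R y)) 2 y ![i, j]
        + ∑ α, ∑ β, S.F2 α β (fun γ => φ γ (rotation R y))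
          * pd i (fun y => φ α (rotation R y)) y * pd j (fun y => φ β (rotation R y)) y
        + S.f0 (fieldArg (fun α y => φ α (rotation R y)) (pullFrame R e) y)
          * pullM R g y i j := by
  filter_upwards [(tendsto_rotation R).eventually h.mem_domf,
    (tendsto_rotation R).eventually h.eq_ricci, ricci_pullM R h.smoothMetric h.symm,
    Filter.eventually_all.2 fun α => hessian_pullM R h.smoothMetric h.symm (h.smooth_φ α)]
    with y hdom heq hricci hhess i j
  have hM : (Matrix.of fun i j => ricci g i j (rotation R y))
      = ∑ α, S.F1 α (fun γ => φ γ (rotation R y)) • (Matrix.of fun i j =>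
          iterCovDeriv g (φ α) 2 (rotation R y) ![i, j])
        + ∑ α, ∑ β, S.F2 α β (fun γ => φ γ (rotation R y)) • (Matrix.of fun i j =>
          pd i (φ α) (rotation R y) * pd j (φ β) (rotation R y))
        + S.f0 (fieldArg φ e (rotation R y)) • g (rotation R y) := by
    ext i j
    simp only [Matrix.of_apply, heq, Matrix.add_apply, Matrix.sum_apply, Matrix.smul_apply,
      smul_eq_mul, mul_assoc]
  rw [hricci, hM, fieldArg_pullFrame, S.f0_scalar _ hR _ hdom]
  simp only [map_add, map_sum, map_smul, Matrix.add_apply, Matrix.sum_apply, Matrix.smul_apply,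
    smul_eq_mul, hhess, conjBy_of_mul, pd_comp_rotation, pullM, mul_assoc]

theorem pull (h : IsSolutionGerm S g φ e)
    (hR : R.1ᵀ ∈ Matrix.specialOrthogonalGroup (Fin 3) ℝ) :
    IsSolutionGerm S (pullM R g) (fun α y => φ α (rotation R y)) (pullFrame R e) where
  smooth_g := contDiffAt_pullM R h.smooth_g
  smooth_φ α := contDiffAt_comp_rotation R (h.smooth_φ α)
  smooth_e := contDiffAt_pullM R h.smooth_e
  symm := pullM_symm R h.symm
  g_zero := by rw [pullM, map_zero, h.g_zero, map_neg, map_one]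
  e_zero := by
    have hone : frameM e 0 = 1 := by
      ext i a
      simp [frameM, h.e_zero, Matrix.one_apply]
    simp [pullFrame, pullM, hone, Matrix.one_apply]
  normal := h.normal_pullM R
  parallel := h.parallel_pullM R
  mem_domF := (tendsto_rotation R).eventually h.mem_domF
  mem_domf := by
    filter_upwards [(tendsto_rotation R).eventually h.mem_domf] with y hy
    rw [fieldArg_pullFrame]
    exact S.domf_scalar _ hR _ hy
  eq_laplacian := by
    filter_upwards [(tendsto_rotation R).eventually h.mem_domf,
      (tendsto_rotation R).eventually h.eq_laplacian, Filter.eventually_all.2 fun α =>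
        laplacian_pullM R h.smoothMetric h.symm (h.smooth_φ α)] with y hdom heq hpull α
    rw [hpull, heq, fieldArg_pullFrame]
    exact (S.f1_scalar _ hR _ hdom α).symm
  eq_ricci := h.eq_ricci_pullM R hR

end IsSolutionGerm

end Covariance

/-! ### Solutions on manifolds in normal coordinates -/

namespace NormalSolution

section Coordinates

variable {n : ℕ} {S : FieldSystem n} {r : WithTop ℕ∞}
  {N : Type u} [TopologicalSpace N] [ChartedSpace E3 N] [IsManifold (𝓡 3) r N]
  (s : NormalSolution S r N)

theorem mem_source (p : N) : p ∈ s.x.source :=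
  s.x_source ▸ Set.mem_univ p

theorem zero_mem_target : (0 : E3) ∈ s.x.target :=
  s.x_q ▸ s.x.map_source (s.mem_source s.q)

theorem target_mem_nhds : s.x.target ∈ 𝓝 (0 : E3) :=
  s.x.open_target.mem_nhds s.zero_mem_target

theorem contMDiff_x : ContMDiff (𝓡 3) (𝓡 3) r s.x :=
  contMDiffOn_univ.1 (s.x_source ▸ contMDiffOn_of_mem_maximalAtlas s.x_mem)

theorem mdifferentiable_x (hr : 1 ≤ r) : s.x.MDifferentiable (𝓡 3) (𝓡 3) :=
  ⟨(contMDiffOn_of_mem_maximalAtlas s.x_mem).mdifferentiableOn (by positivity),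
    (contMDiffOn_symm_of_mem_maximalAtlas s.x_mem).mdifferentiableOn (by positivity)⟩

theorem contDiffAt_φ (α : Fin n) : ContDiffAt ℝ r (s.φ α ∘ s.x.symm) 0 :=
  ContMDiffAt.contDiffAt <| (s.φ_reg α).contMDiffAt.comp 0
    (contMDiffAt_symm_of_mem_maximalAtlas s.x_mem s.zero_mem_target)

theorem contDiffAt_metric (i j : Fin 3) :
    ContDiffAt ℝ r (fun y => metricInChart s.x s.h y i j) 0 :=
  (s.h_reg i j).contDiffAt s.target_mem_nhds

theorem mfderiv_x_symm_single (hr : 1 ≤ r) (a : Fin 3) :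
    mfderiv (𝓡 3) (𝓡 3) s.x.symm (0 : E3) (EuclideanSpace.single a (1 : ℝ) : E3)
      = s.c a (s.x.symm 0) := by
  have hd := s.mdifferentiable_x hr
  refine hd.mfderiv_injective (s.x.map_target s.zero_mem_target) ?_
  have hinv := DFunLike.congr_fun (hd.comp_symm_deriv s.zero_mem_target)
    (EuclideanSpace.single a (1 : ℝ) : E3)
  refine hinv.trans (PiLp.ext (x := (EuclideanSpace.single a (1 : ℝ) : E3)) fun i => ?_)
  refine Eq.trans ?_ (s.c_q i a).symm
  simp

theorem metricInChart_zero (hr : 1 ≤ r) : metricInChart s.x s.h 0 = -1 := by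
  ext i j
  simp only [metricInChart, Matrix.of_apply, s.mfderiv_x_symm_single hr, s.c_orthonormal,
    Matrix.neg_apply, Matrix.one_apply]
  split_ifs <;> simp

theorem isSolutionGerm (hr : ∞ ≤ r) : IsSolutionGerm S (metricInChart s.x s.h)
    (fun α => s.φ α ∘ s.x.symm) (frameInChart s.x s.c) where
  smooth_g i j := (s.contDiffAt_metric i j).of_le hr
  smooth_φ α := (s.contDiffAt_φ α).of_le hr
  smooth_e i a := ((s.c_reg i a).contDiffAt s.target_mem_nhds).of_le hr
  symm _ _ _ := s.h_symm _ _ _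
  g_zero := s.metricInChart_zero (le_trans (by exact_mod_cast le_top) hr)
  e_zero := s.c_q
  normal := eventually_of_mem s.target_mem_nhds s.x_normal
  parallel := eventually_of_mem s.target_mem_nhds s.c_parallel
  mem_domF := eventually_of_mem s.target_mem_nhds s.mem_domF
  mem_domf := eventually_of_mem s.target_mem_nhds s.mem_domf
  eq_laplacian := eventually_of_mem s.target_mem_nhds s.eq_laplacian
  eq_ricci := eventually_of_mem s.target_mem_nhds s.eq_ricci

theorem coeff_eq_iterCovDeriv (α : Fin n) (p : ℕ) : s.coeff α p
    = iterCovDeriv (metricInChart s.x s.h) (s.φ α ∘ s.x.symm) p 0 := by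
  rw [← rotate_one (iterCovDeriv (metricInChart s.x s.h) (s.φ α ∘ s.x.symm) p 0)]
  funext a
  simp only [coeff, rotate, s.c_q, Matrix.one_apply, eq_comm]

theorem h_mfderiv_symm (y u w : E3) :
    s.h (s.x.symm y) (mfderiv (𝓡 3) (𝓡 3) s.x.symm y u) (mfderiv (𝓡 3) (𝓡 3) s.x.symm y w)
      = ∑ i, ∑ j, u i * w j * metricInChart s.x s.h y i j := by
  let L : E3 →L[ℝ] E3 := mfderiv (𝓡 3) (𝓡 3) s.x.symm y
  let B : E3 →L[ℝ] E3 →L[ℝ] ℝ := s.h (s.x.symm y)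
  have hbasis (v : E3) : v = ∑ i, v i • (EuclideanSpace.single i 1 : E3) := by
    ext j
    simp [Finset.sum_apply, Pi.single_apply]
  change B (L u) (L w) = ∑ i, ∑ j, u i * w j * B (L (EuclideanSpace.single i (1 : ℝ)))
    (L (EuclideanSpace.single j (1 : ℝ)))
  conv_lhs => rw [hbasis u, hbasis w]
  simp only [map_sum, map_smul, sum_apply, smul_apply, smul_eq_mul, Finset.mul_sum]
  rw [Finset.sum_comm]
  exact Finset.sum_congr rfl fun i _ => Finset.sum_congr rfl fun j _ => by ring

end Coordinates

section Transition

variable {n : ℕ} {S : FieldSystem n} {r : WithTop ℕ∞}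
  {N : Type u} [TopologicalSpace N] [ChartedSpace E3 N] [IsManifold (𝓡 3) r N]
  {N' : Type v} [TopologicalSpace N'] [ChartedSpace E3 N'] [IsManifold (𝓡 3) r N']
  (s : NormalSolution S r N) (s' : NormalSolution S r N') (R : Matrix.orthogonalGroup (Fin 3) ℝ)

/-- The partial map between the manifolds of two solutions that reads `y ↦ R y` in their normal
coordinates. -/
def transition : OpenPartialHomeomorph N N' :=
  (s.x.trans (rotation R).toHomeomorph.toOpenPartialHomeomorph).trans s'.x.symm

theorem transition_apply (p : N) : s.transition s' R p = s'.x.symm (rotation R (s.x p)) := rfl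

theorem transition_x_symm {y : E3} (hy : y ∈ s.x.target) :
    s.transition s' R (s.x.symm y) = s'.x.symm (rotation R y) := by
  rw [transition_apply, s.x.right_inv hy]

theorem transition_q : s.transition s' R s.q = s'.q := by
  rw [transition_apply, s.x_q, map_zero, ← s'.x_q, s'.x.left_inv (s'.mem_source _)]

theorem mem_transition_source {p : N} :
    p ∈ (s.transition s' R).source ↔ rotation R (s.x p) ∈ s'.x.target := by
  simp [transition, s.x_source]

theorem mem_transition_target {p : N'} :
    p ∈ (s.transition s' R).target ↔ (rotation R).symm (s'.x p) ∈ s.x.target := by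
  simp [transition, s'.x_source]

theorem contMDiffOn_transition :
    ContMDiffOn (𝓡 3) (𝓡 3) r (s.transition s' R) (s.transition s' R).source :=
  (contMDiffOn_symm_of_mem_maximalAtlas s'.x_mem).comp
    ((rotation R).contDiff.contMDiff.comp s.contMDiff_x).contMDiffOn
    fun _ hp => (s.mem_transition_source s' R).1 hp

theorem contMDiffOn_transition_symm :
    ContMDiffOn (𝓡 3) (𝓡 3) r (s.transition s' R).symm (s.transition s' R).target :=
  (contMDiffOn_symm_of_mem_maximalAtlas s.x_mem).comp
    ((rotation R).symm.contDiff.contMDiff.comp s'.contMDiff_x).contMDiffOn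
    fun _ hp => (s.mem_transition_target s' R).1 hp

variable {s s' R} in
theorem mfderiv_transition (hr : 1 ≤ r) {y : E3} (hy : y ∈ s.x.target)
    (hy' : rotation R y ∈ s'.x.target) (u : E3) :
    (mfderiv (𝓡 3) (𝓡 3) (s.transition s' R) (s.x.symm y)
        (mfderiv (𝓡 3) (𝓡 3) s.x.symm y u) : E3)
      = (mfderiv (𝓡 3) (𝓡 3) s'.x.symm (rotation R y) (rotation R u) : E3) := by
  have hsource : s.x.symm y ∈ (s.transition s' R).source := by
    rwa [mem_transition_source, s.x.right_inv hy]
  have hdiff : MDifferentiableAt (𝓡 3) (𝓡 3) (s.transition s' R) (s.x.symm y) :=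
    ((s.contMDiffOn_transition s' R).contMDiffAt
      ((s.transition s' R).open_source.mem_nhds hsource)).mdifferentiableAt (by positivity)
  have hleft := mfderiv_comp y hdiff ((s.mdifferentiable_x hr).mdifferentiableAt_symm hy)
  have hright := mfderiv_comp y ((s'.mdifferentiable_x hr).mdifferentiableAt_symm hy')
    ((rotation R).differentiableAt (x := y)).mdifferentiableAt
  have hcoord : s.transition s' R ∘ s.x.symm =ᶠ[𝓝 y] s'.x.symm ∘ rotation R :=
    eventually_of_mem (s.x.open_target.mem_nhds hy) fun _ => s.transition_x_symm s' R
  have hrot : mfderiv (𝓡 3) (𝓡 3) (rotation R) y u = rotation R u := by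
    rw [mfderiv_eq_fderiv, (rotation R).fderiv]
    rfl
  have hcomp := DFunLike.congr_fun
    (hleft.symm.trans ((hcoord.mfderiv_eq (I := 𝓡 3) (I' := 𝓡 3)).trans hright)) u
  refine hcomp.trans ?_
  change mfderiv (𝓡 3) (𝓡 3) s'.x.symm (rotation R y) (mfderiv (𝓡 3) (𝓡 3) (rotation R) y u) = _
  rw [hrot]

variable {s s' R} in
theorem h_mfderiv_transition (hr : 1 ≤ r) {p : N} (hp : p ∈ (s.transition s' R).source)
    (hg : metricInChart s.x s.h (s.x p) = pullM R (metricInChart s'.x s'.h) (s.x p))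
    (v w : TangentSpace (𝓡 3) p) :
    s'.h (s.transition s' R p) (mfderiv (𝓡 3) (𝓡 3) (s.transition s' R) p v)
      (mfderiv (𝓡 3) (𝓡 3) (s.transition s' R) p w) = s.h p v w := by
  obtain ⟨y, hy, rfl⟩ : ∃ y ∈ s.x.target, s.x.symm y = p :=
    ⟨s.x p, s.x.map_source (s.mem_source p), s.x.left_inv (s.mem_source p)⟩
  rw [mem_transition_source, s.x.right_inv hy] at hp
  rw [s.x.right_inv hy] at hg
  obtain ⟨u : E3, rfl⟩ := (s.mdifferentiable_x hr).symm.mfderiv_surjective hy v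
  obtain ⟨z : E3, rfl⟩ := (s.mdifferentiable_x hr).symm.mfderiv_surjective hy w
  -- forgets that the tangent spaces depend on the base point
  let H : N' → E3 → E3 → ℝ := fun p v w => s'.h p v w
  calc H (s.transition s' R (s.x.symm y))
        (mfderiv (𝓡 3) (𝓡 3) (s.transition s' R) (s.x.symm y)
          (mfderiv (𝓡 3) (𝓡 3) s.x.symm y u))
        (mfderiv (𝓡 3) (𝓡 3) (s.transition s' R) (s.x.symm y)
          (mfderiv (𝓡 3) (𝓡 3) s.x.symm y z))
    _ = H (s'.x.symm (rotation R y))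
          (mfderiv (𝓡 3) (𝓡 3) s'.x.symm (rotation R y) (rotation R u))
          (mfderiv (𝓡 3) (𝓡 3) s'.x.symm (rotation R y) (rotation R z)) := by
      rw [s.transition_x_symm s' R hy]
      exact congrArg₂ (H _) (mfderiv_transition hr hy hp u) (mfderiv_transition hr hy hp z)
    _ = ∑ i, ∑ j, rotation R u i * rotation R z j
          * metricInChart s'.x s'.h (rotation R y) i j := s'.h_mfderiv_symm _ _ _
    _ = ∑ i, ∑ j, u i * z j * metricInChart s.x s.h y i j := by
      rw [sum_rotation_mul_rotation, hg, pullM]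
    _ = _ := (s.h_mfderiv_symm y u z).symm

end Transition

theorem locallyIsometric_of_eventuallyEq {n : ℕ} {S : FieldSystem n}
    {N : Type u} [TopologicalSpace N] [ChartedSpace E3 N] [IsManifold (𝓡 3) ω N]
    {N' : Type v} [TopologicalSpace N'] [ChartedSpace E3 N'] [IsManifold (𝓡 3) ω N']
    {s : NormalSolution S ω N} {s' : NormalSolution S ω N'} {R : Matrix.orthogonalGroup (Fin 3) ℝ}
    (hg : metricInChart s.x s.h =ᶠ[𝓝 0] pullM R (metricInChart s'.x s'.h))
    (hφ : ∀ᶠ y in 𝓝 (0 : E3), ∀ α, s.φ α (s.x.symm y) = s'.φ α (s'.x.symm (rotation R y))) :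
    LocallyIsometric s s' := by
  obtain ⟨V, hV, hVo, h0V⟩ := eventually_nhds_iff.1 (hg.and hφ)
  let Ψ := (s.transition s' R).restrOpen (s.x ⁻¹' V) (hVo.preimage s.contMDiff_x.continuous)
  have hΨ {p : N} (hp : p ∈ Ψ.source) : p ∈ (s.transition s' R).source ∧ s.x p ∈ V := hp
  refine ⟨Ψ, ⟨?_, ?_⟩, s.transition_q s' R,
    (s.contMDiffOn_transition s' R).mono fun p hp => (hΨ hp).1,
    (s.contMDiffOn_transition_symm s' R).mono fun p hp => hp.1,
    fun p hp v w => h_mfderiv_transition le_top (hΨ hp).1 (hV _ (hΨ hp).2).1 v w,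
    fun p hp α => ?_⟩
  · exact (s.mem_transition_source s' R).2 (by simpa [s.x_q] using s'.zero_mem_target)
  · simpa [s.x_q] using h0V
  · have hp' := (hV _ (hΨ hp).2).2 α
    rw [s.x.left_inv (s.mem_source p)] at hp'
    exact hp'.symm

theorem coeff_eq_of_nullSpinor {n : ℕ} {S : FieldSystem n} {r : WithTop ℕ∞} (hr : ∞ ≤ r)
    {N : Type u} [TopologicalSpace N] [ChartedSpace E3 N] [IsManifold (𝓡 3) r N]
    {N' : Type v} [TopologicalSpace N'] [ChartedSpace E3 N'] [IsManifold (𝓡 3) r N']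
    (s : NormalSolution S r N) (s' : NormalSolution S r N')
    (h : ∀ α p, s.nullSpinor α p = s'.nullSpinor α p) (α : Fin n) (p : ℕ) :
    s.coeff α p = s'.coeff α p := by
  have hjet (m : ℕ) := (s.isSolutionGerm hr).jetEq (s'.isSolutionGerm hr) (fun α p hmem =>
    congrFun (eq_of_symPart_toSpinor_eq hmem (by
      simpa only [nullSpinor, coeffSpinor, coeff_eq_iterCovDeriv] using h α p))) m
  rw [coeff_eq_iterCovDeriv, coeff_eq_iterCovDeriv]
  exact funext ((hjet p).1.iterCovDeriv_eq ((hjet (p + 1)).2.1 α))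

theorem locallyIsometric_of_nullTensor {n : ℕ} {S : FieldSystem n}
    {N : Type u} [TopologicalSpace N] [ChartedSpace E3 N] [IsManifold (𝓡 3) ω N]
    {N' : Type v} [TopologicalSpace N'] [ChartedSpace E3 N'] [IsManifold (𝓡 3) ω N']
    (s : NormalSolution S ω N) (s' : NormalSolution S ω N')
    {R : Matrix (Fin 3) (Fin 3) ℝ} (hR : R ∈ Matrix.specialOrthogonalGroup (Fin 3) ℝ)
    (h : ∀ α p, s'.nullTensor α p = rotate R (s.nullTensor α p)) : LocallyIsometric s s' := by
  have hRT : Rᵀ ∈ Matrix.specialOrthogonalGroup (Fin 3) ℝ :=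
    Matrix.mem_specialOrthogonalGroup_iff.2 ⟨Unitary.star_mem hR.1,
      (Matrix.det_transpose R).trans (Matrix.mem_specialOrthogonalGroup_iff.1 hR).2⟩
  lift R to Matrix.orthogonalGroup (Fin 3) ℝ using hR.1
  have hs' := s'.isSolutionGerm le_top
  have hcoeff (α : Fin n) (p : ℕ) : iterCovDeriv (pullM R (metricInChart s'.x s'.h))
      (fun y => (s'.φ α ∘ s'.x.symm) (rotation R y)) p 0 = rotate R.1ᵀ (s'.coeff α p) := by
    rw [(iterCovDeriv_pullM R hs'.smoothMetric hs'.symm (hs'.smooth_φ α) p).self_of_nhds,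
      map_zero, coeff_eq_iterCovDeriv]
  have hnull (α : Fin n) (p : ℕ) :
      stfPart (s.coeff α p) = stfPart (rotate R.1ᵀ (s'.coeff α p)) := by
    have hα : stfPart (s'.coeff α p) = rotate R (stfPart (s.coeff α p)) := h α p
    rw [stfPart_rotate (by simpa using mul_transpose_self_of_orthogonal R), hα, rotate_rotate,
      transpose_mul_self_of_orthogonal, rotate_one]
  have hjet (m : ℕ) := (s.isSolutionGerm le_top).jetEq (hs'.pull R hRT) (fun α p hmem =>
    congrFun (eq_of_stfPart_eq hmem (by rw [hcoeff, ← coeff_eq_iterCovDeriv, hnull]))) m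
  refine locallyIsometric_of_eventuallyEq (R := R) ?_ ?_
  · have hentry : ∀ᶠ y in 𝓝 (0 : E3), ∀ i j, metricInChart s.x s.h y i j
        = pullM R (metricInChart s'.x s'.h) y i j :=
      Filter.eventually_all.2 fun i => Filter.eventually_all.2 fun j => eventuallyEq_of_jetEq
        (s.contDiffAt_metric i j).analyticAt
        (contDiffAt_pullM R s'.contDiffAt_metric i j).analyticAt fun m => (hjet m).1.jetEq i j
    exact hentry.mono fun y hy => Matrix.ext hy
  · exact Filter.eventually_all.2 fun α => eventuallyEq_of_jetEq (s.contDiffAt_φ α).analyticAt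
      (contDiffAt_comp_rotation R (s'.contDiffAt_φ α)).analyticAt fun m => (hjet m).2.1 α

end NormalSolution

end NullData

end

theorem lemma2p1 {n : ℕ} (S : NullData.FieldSystem n) :
    -- the normal expansion coefficients satisfy the reality condition and are determined by the data
    (∀ (ψ : Fin n → (p : ℕ) → NullData.Spinor p),
      (∀ α p, NullData.TotallySymmetric (ψ α p)) →
      (∀ α p, NullData.RealityCondition (ψ α p)) →
      ∀ (r : WithTop ℕ∞), ∞ ≤ r →
      ∀ (N : Type u) [TopologicalSpace N] [ChartedSpace NullData.E3 N] [IsManifold (𝓡 3) r N]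
        (s : NullData.NormalSolution S r N),
        (∀ α p, s.nullSpinor α p = ψ α p) →
        (∀ α p, NullData.RealityCondition (s.coeffSpinor α p)) ∧
        ∀ (N' : Type v) [TopologicalSpace N'] [ChartedSpace NullData.E3 N']
          [IsManifold (𝓡 3) r N'] (s' : NullData.NormalSolution S r N'),
          (∀ α p, s'.nullSpinor α p = ψ α p) →
          ∀ α p, s'.coeffSpinor α p = s.coeffSpinor α p) ∧
    -- analytic solutions whose null data differ by a rotation are isometric
    (∀ (N : Type u) [TopologicalSpace N] [ChartedSpace NullData.E3 N] [IsManifold (𝓡 3) ω N]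
        (N' : Type v) [TopologicalSpace N'] [ChartedSpace NullData.E3 N'] [IsManifold (𝓡 3) ω N']
        (s : NullData.NormalSolution S ω N) (s' : NullData.NormalSolution S ω N'),
        (∃ R ∈ Matrix.specialOrthogonalGroup (Fin 3) ℝ,
          ∀ α p, s'.nullTensor α p = NullData.rotate R (s.nullTensor α p)) →
        NullData.LocallyIsometric s s') := by
  refine ⟨fun ψ _ _ r hr N _ _ _ s hs => ⟨fun α p => NullData.realityCondition_toSpinor _,
    fun N' _ _ _ s' hs' α p => ?_⟩, fun N _ _ _ N' _ _ _ s s' ⟨R, hR, h⟩ =>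
      s.locallyIsometric_of_nullTensor s' hR h⟩
  rw [NullData.NormalSolution.coeffSpinor, NullData.NormalSolution.coeffSpinor,
    s.coeff_eq_of_nullSpinor hr s' fun α p => (hs α p).trans (hs' α p).symm]
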